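/- Fix $n\in\mathbb N$. Say that $n\times n$ matrices have the *BMV property* if for every Hermitian $A\in\mathbb C^{n\times n}$ and every positive semidefinite $B\in\mathbb C^{n\times n}$ there is a positive measure $\mu$ supported in $[0,\infty)$ such that $\operatorname{Tr} e^{A-\lambda B}=\int e^{-\lambda s}\,d\mu(s)$ for all $\lambda\in\mathbb R$. Let $A,B\in\mathbb C^{n\times n}$ be positive semidefinite, let $p\in\mathbb R$, and put $F_p(\lambda)=\operatorname{Tr}(A+\lambda B)^p$ for $\lambda\ge 0$ (for $p<0$, wherever $A+\lambda B$ is invertible), where powers are taken by the functional calculus. Derivatives are those of $F_p$ as a function on $[0,\infty)$, i.e. one-sided at $\lambda=0$. Let $r\in\mathbb N$. (a) Suppose the BMV property holds. If $1\le r\le\lceil p\rceil$, then $F_p^{(r)}(\lambda)\ge 0$ for all $\lambda\ge 0$. (b) (Without assuming the BMV property.) If $p>0$ and $r\ge\lceil p\rceil$, then $(-1)^{r-\lceil p\rceil}F_p^{(r)}(\lambda)\ge 0$ for all $\lambda\ge 0$. (c) Suppose the BMV property holds. If $p\le 0$ and $r\ge 1$, then $(-1)^rF_p^{(r)}(\lambda)\ge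 0$ for all $\lambda\ge 0$ such that, if $p<0$, $A+\lambda B$ is positive definite. In (c), $F_p$ is $r$ times continuously differentiable near each such $\lambda$. In (a) and (b), $F_p$ is $r$ times continuously differentiable near every $\lambda>0$, and also at $\lambda=0$ if $A$ is positive definite, or if $r\le p$ (in (a)), or if $p$ is an integer (in (b)). In the remaining case ($\lambda=0$, $A$ singular, $p$ not an integer, $r>p$) the one-sided derivative need not exist, and the inequality is asserted whenever it does. -/

import Mathlib

open scoped ComplexOrder

/-- The real power `M ^ p` of a Hermitian matrix, by the functional calculus: if
`M = U diag(x₁, …, xₙ) U*` then `M ^ p = U diag(x₁ ^ p, …, xₙ ^ p) U*`. It is only used for `M`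
positive semidefinite, and positive definite if `p < 0`. -/
noncomputable def matrixPow {n : ℕ} (M : Matrix (Fin n) (Fin n) ℂ) (p : ℝ) :
    Matrix (Fin n) (Fin n) ℂ :=
  cfc (fun x : ℝ => x ^ p) M

/-- `l ↦ Tr (A + l B) ^ p`. The trace is real whenever `A` and `B` are Hermitian. -/
noncomputable def tracePow {n : ℕ} (A B : Matrix (Fin n) (Fin n) ℂ) (p : ℝ) (l : ℝ) : ℝ :=
  (matrixPow (A + l • B) p).trace.re

/-- A function `f` on the real line is the Laplace transform of a positive measure supported
in `[0, ∞)`. -/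
def IsLaplaceOfPositive (f : ℝ → ℂ) : Prop :=
  ∃ μ : MeasureTheory.Measure ℝ, μ (Set.Iio 0) = 0 ∧
    ∀ l : ℝ, MeasureTheory.Integrable (fun s => Real.exp (-(l * s))) μ ∧
      f l = ((∫ s, Real.exp (-(l * s)) ∂μ : ℝ) : ℂ)

/-- The Bessis-Moussa-Villani property for `n × n` matrices. -/
def BMVProperty (n : ℕ) : Prop :=
  ∀ A B : Matrix (Fin n) (Fin n) ℂ, A.IsHermitian → B.PosSemidef →
    IsLaplaceOfPositive (fun l : ℝ => (NormedSpace.exp (A - l • B)).trace)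

/-! All signs come from integral representations. For (c) with q = -p > 0, Tr (A + λB)^(-q) is
Γ(q)⁻¹ times the integral of t^(q-1) Tr e^(-t(A + λB)) over t > 0, and BMV makes each integrand
completely monotone in λ. Part (b) is elementary: for p = m + q with 0 < q < 1, x^p is a positive
multiple of the integral of t^q x^m (1/t - 1/(t + x)), and for each t the integrand is a polynomial
in x of degree at most m minus t^q (-t)^m / (t + x). Order r ≥ m + 1 kills the polynomial, while Tr
(t + A + λB)⁻¹ is a positive combination of functions 1/(1 + λb) with b ≥ 0. For integer p the trace
is a polynomial in λ with top coefficient Tr B^p ≥ 0.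

In (a), r = ⌈p⌉ belongs to (b). For r < p and A positive definite, put q = p - r. Lagrange inversion
(`iteratedDeriv_trace_oneAddRpow_inverse_mul`) says that the r-th derivative at 0 of Tr ((1 +
λB)⁻¹A)^q is (-1)^r q/p times that of Tr (A + λB)^p. Since (1 + λB)⁻¹A is similar to the inverse of
some A' + λB', the former is a derivative of Tr (A' + λB')^(-q), whose sign is known from (c).

Signs are proved for forward differences, which commute with integrals at no cost, and passed to
derivatives by the mean value theorem. If A + λB is singular for λ > 0, the common kernel of A and B
is filled in by its projection. At λ = 0, monotonicity of lower derivatives supplies signs and, for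
r < p, the limits that give smoothness. -/

/-! ### Forward differences, derivatives and the endpoint 0 -/

open scoped ContDiff in
theorem ContDiffAt.contDiffAt_deriv {f : ℝ → ℝ} {x : ℝ} (hf : ContDiffAt ℝ ∞ f x) :
    ContDiffAt ℝ ∞ (deriv f) x := by
  exact hf.derivWithin (by simp)

open scoped ContDiff in
theorem ContDiffAt.contDiffAt_iteratedDeriv {f : ℝ → ℝ} {x : ℝ} (hf : ContDiffAt ℝ ∞ f x) (j : ℕ) :
    ContDiffAt ℝ ∞ (iteratedDeriv j f) x := by
  induction j with
  | zero => simpa using hf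
  | succ j ih =>
    rw [iteratedDeriv_succ]
    exact ih.contDiffAt_deriv

open scoped ContDiff in
theorem ContDiffAt.differentiableAt_iteratedDeriv {f : ℝ → ℝ} {x : ℝ} (hf : ContDiffAt ℝ ∞ f x)
    (j : ℕ) : DifferentiableAt ℝ (iteratedDeriv j f) x :=
  (hf.contDiffAt_iteratedDeriv j).differentiableAt (by simp)

open scoped ContDiff Topology in
-- Mean value theorem for iterated differences: apply order r to y ↦ f (y + h) - f y, then the
-- ordinary mean value theorem to the r-th derivative.
theorem exists_fwdDiff_iter_eq (r : ℕ) {h : ℝ} (hh : 0 < h) (f : ℝ → ℝ)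
    (hf : ∀ x, 0 < x → ContDiffAt ℝ ∞ f x) {l : ℝ} (hl : 0 < l) :
    ∃ ξ ∈ Set.Icc l (l + r * h), (fwdDiff h)^[r] f l = h ^ r * iteratedDeriv r f ξ := by
  induction r generalizing f with
  | zero => exact ⟨l, by simp, by simp⟩
  | succ r ih =>
    have hshift : ∀ x, 0 < x → ContDiffAt ℝ ∞ (fun y => f (y + h)) x := fun x hx =>
      ContDiffAt.comp x (hf (x + h) (by linarith)) (by fun_prop)
    obtain ⟨ξ, hξ, hξ'⟩ := ih (fun y => f (y + h) - f y) fun x hx => (hshift x hx).sub (hf x hx)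
    have hξ0 : 0 < ξ := hl.trans_le hξ.1
    have hsub : iteratedDeriv r (fun y => f (y + h) - f y) ξ =
        iteratedDeriv r f (ξ + h) - iteratedDeriv r f ξ := by
      rw [iteratedDeriv_fun_sub ((hshift ξ hξ0).of_le (by exact_mod_cast le_top))
        ((hf ξ hξ0).of_le (by exact_mod_cast le_top)), iteratedDeriv_comp_add_const]
    have hdiff : ∀ x, 0 < x → DifferentiableAt ℝ (iteratedDeriv r f) x := fun x hx =>
      (hf x hx).differentiableAt_iteratedDeriv r
    obtain ⟨η, hη, hη'⟩ := exists_deriv_eq_slope (iteratedDeriv r f)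
      (show ξ < ξ + h by linarith)
      (fun x hx => (hdiff x (hξ0.trans_le hx.1)).continuousAt.continuousWithinAt)
      (fun x hx => (hdiff x (hξ0.trans hx.1)).differentiableWithinAt)
    refine ⟨η, ⟨hξ.1.trans hη.1.le, ?_⟩, ?_⟩
    · have := hξ.2
      have := hη.2
      push_cast
      linarith
    · rw [Function.iterate_succ_apply]
      change (fwdDiff h)^[r] (fun y => f (y + h) - f y) l = _
      rw [hξ', hsub, iteratedDeriv_succ, hη', add_sub_cancel_left]
      field_simp
      ring

open scoped ContDiff Topology in
/-- If all forward differences of order `r` have the sign of `σ`, so has the `r`-th derivative. -/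
theorem iteratedDeriv_nonneg_of_fwdDiff_iter_nonneg {r : ℕ} {σ : ℝ} {f : ℝ → ℝ}
    (hf : ∀ x, 0 < x → ContDiffAt ℝ ∞ f x)
    (hd : ∀ l h : ℝ, 0 < l → 0 < h → 0 ≤ σ * (fwdDiff h)^[r] f l) {l : ℝ} (hl : 0 < l) :
    0 ≤ σ * iteratedDeriv r f l := by
  by_contra! hneg
  have hcont : ContinuousAt (fun x => σ * iteratedDeriv r f x) l :=
    continuousAt_const.mul ((hf l hl).differentiableAt_iteratedDeriv r).continuousAt
  obtain ⟨ε, hε, hball⟩ := Metric.eventually_nhds_iff.1 (hcont.eventually_lt_const hneg)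
  -- The step size keeps the intermediate point, at distance at most r * h from l, inside the ball
  -- where the derivative has the wrong sign.
  have hh : 0 < ε / (r + 1) := by positivity
  obtain ⟨ξ, hξ, hξ'⟩ := exists_fwdDiff_iter_eq r hh f hf hl
  have h1 : (r : ℝ) * (ε / (r + 1)) < ε := by
    rw [mul_div_assoc', div_lt_iff₀ (by positivity)]
    nlinarith
  have h2 := hball (y := ξ) (by
    rw [Real.dist_eq, abs_of_nonneg (by linarith [hξ.1])]
    linarith [hξ.2])
  have h3 := hd l _ hl hh
  rw [hξ'] at h3
  have : 0 < (ε / (r + 1)) ^ r := by positivity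
  nlinarith

theorem iteratedDerivWithin_Ici_eq_of_pos (r : ℕ) (f : ℝ → ℝ) {l : ℝ} (hl : 0 < l) :
    iteratedDerivWithin r f (Set.Ici 0) l = iteratedDeriv r f l := by
  rw [← iteratedDerivWithin_univ]
  simp only [iteratedDerivWithin]
  rw [iteratedFDerivWithin_congr_set' (t := Set.univ) (y := l)]
  exact Filter.eventuallyEq_univ.2 (mem_nhdsWithin_of_mem_nhds (Ici_mem_nhds hl))

open scoped ContDiff Topology in
-- At 0, either the derivative of order r - 1 is differentiable, hence continuous there and monotone
-- up to the sign σ, or the r-th derivative takes its default value 0.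
theorem iteratedDerivWithin_Ici_nonneg {r : ℕ} (hr : 1 ≤ r) {σ : ℝ} {f : ℝ → ℝ}
    (hf : ∀ x, 0 < x → ContDiffAt ℝ ∞ f x)
    (hd : ∀ x, 0 < x → 0 ≤ σ * iteratedDeriv r f x) {l : ℝ} (hl : 0 ≤ l) :
    0 ≤ σ * iteratedDerivWithin r f (Set.Ici 0) l := by
  rcases hl.eq_or_lt with rfl | hl
  swap
  · rw [iteratedDerivWithin_Ici_eq_of_pos r f hl]
    exact hd l hl
  obtain ⟨r, rfl⟩ := Nat.exists_eq_add_of_le' hr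
  rw [iteratedDerivWithin_succ]
  set g := iteratedDerivWithin r f (Set.Ici 0) with hg
  by_cases hgd : DifferentiableWithinAt ℝ g (Set.Ici 0) 0
  swap
  · rw [derivWithin_zero_of_not_differentiableWithinAt hgd, mul_zero]
  have heq : ∀ x, 0 < x → g x = iteratedDeriv r f x := fun x hx =>
    iteratedDerivWithin_Ici_eq_of_pos r f hx
  have heq' : ∀ x, 0 < x → g =ᶠ[𝓝 x] iteratedDeriv r f := fun x hx => by
    filter_upwards [Ioi_mem_nhds hx] with y hy using heq y hy
  have hdiff : ∀ x, 0 < x → DifferentiableAt ℝ g x := fun x hx =>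
    ((hf x hx).differentiableAt_iteratedDeriv r).congr_of_eventuallyEq (heq' x hx)
  have hmono : MonotoneOn (fun x => σ * g x) (Set.Ici 0) := by
    apply monotoneOn_of_deriv_nonneg (convex_Ici 0)
    · intro x hx
      rcases (Set.mem_Ici.1 hx).eq_or_lt with rfl | hx
      · exact hgd.continuousWithinAt.const_mul σ
      · exact ((hdiff x hx).continuousAt.const_mul σ).continuousWithinAt
    · rw [interior_Ici]
      exact fun x hx => ((hdiff x hx).const_mul σ).differentiableWithinAt
    · rw [interior_Ici]
      intro x hx
      rw [deriv_const_mul _ (hdiff x hx), (heq' x hx).deriv_eq, ← iteratedDeriv_succ]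
      exact hd x hx
  rw [← derivWithin_const_mul _ hgd]
  exact hmono.derivWithin_nonneg

open scoped ContDiff Topology in
/-- A function that is continuous on `[0, ∞)` and whose derivatives on `(0, ∞)` up to order `r`
have limits at `0` is `r` times continuously differentiable on `[0, ∞)`. -/
theorem contDiffOn_Ici_of_tendsto_iteratedDeriv (r : ℕ) {f : ℝ → ℝ}
    (hc : ContinuousOn f (Set.Ici 0)) (hf : ∀ x, 0 < x → ContDiffAt ℝ ∞ f x)
    (hlim : ∀ j, 1 ≤ j → j ≤ r → ∃ a, Filter.Tendsto (iteratedDeriv j f) (𝓝[>] 0) (𝓝 a)) :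
    ContDiffOn ℝ r f (Set.Ici 0) := by
  induction r generalizing f with
  | zero => simpa using hc
  | succ r ih =>
    obtain ⟨a, ha⟩ := hlim 1 le_rfl (by omega)
    rw [iteratedDeriv_one] at ha
    have hdiff : ∀ x, 0 < x → DifferentiableAt ℝ f x := fun x hx =>
      (hf x hx).differentiableAt (by simp)
    have h0 : HasDerivWithinAt f a (Set.Ici 0) 0 :=
      hasDerivWithinAt_Ici_of_tendsto_deriv (s := Set.Ioi 0)
        (fun x hx => (hdiff x hx).differentiableWithinAt)
        ((hc 0 Set.self_mem_Ici).mono Set.Ioi_subset_Ici_self) self_mem_nhdsWithin ha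
    set g : ℝ → ℝ := derivWithin f (Set.Ici 0) with hg
    have hgd : ∀ x, 0 < x → g x = deriv f x := fun x hx => by
      rw [hg, derivWithin_of_mem_nhds (Ici_mem_nhds hx)]
    have hge : ∀ x, 0 < x → g =ᶠ[𝓝 x] deriv f := fun x hx => by
      filter_upwards [Ioi_mem_nhds hx] with y hy using hgd y hy
    have hg0 : g 0 = a := h0.derivWithin (uniqueDiffOn_Ici 0 0 Set.self_mem_Ici)
    have hgs : ∀ x, 0 < x → ContDiffAt ℝ ∞ g x := fun x hx => by
      refine ContDiffAt.congr_of_eventuallyEq ?_ (hge x hx)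
      exact (hf x hx).contDiffAt_deriv
    have hgc : ContinuousOn g (Set.Ici 0) := by
      intro x hx
      rcases (Set.mem_Ici.1 hx).eq_or_lt with rfl | hx
      · rw [← continuousWithinAt_Ioi_iff_Ici, ContinuousWithinAt, hg0]
        refine ha.congr' ?_
        filter_upwards [self_mem_nhdsWithin] with y hy using (hgd y hy).symm
      · exact (hgs x hx).continuousAt.continuousWithinAt
    push_cast
    rw [contDiffOn_succ_iff_derivWithin (uniqueDiffOn_Ici 0)]
    refine ⟨?_, by simp, ih hgc hgs ?_⟩
    · intro x hx
      rcases (Set.mem_Ici.1 hx).eq_or_lt with rfl | hx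
      · exact h0.differentiableWithinAt
      · exact (hdiff x hx).differentiableWithinAt
    · intro j hj hjr
      obtain ⟨b, hb⟩ := hlim (j + 1) (by omega) (by omega)
      refine ⟨b, hb.congr' ?_⟩
      filter_upwards [self_mem_nhdsWithin] with y hy
      rw [iteratedDeriv_succ', (hge y hy).iteratedDeriv_eq]

open scoped ContDiff Topology in
-- Derivatives of orders 1 to r are monotone, as the next one is nonnegative, and bounded below by
-- 0, so they have limits at 0. Hence the need for signs up to order r + 1.
theorem contDiffOn_Ici_of_iteratedDeriv_nonneg (r : ℕ) {f : ℝ → ℝ}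
    (hc : ContinuousOn f (Set.Ici 0)) (hf : ∀ x, 0 < x → ContDiffAt ℝ ∞ f x)
    (hd : ∀ j, 1 ≤ j → j ≤ r + 1 → ∀ x, 0 < x → 0 ≤ iteratedDeriv j f x) :
    ContDiffOn ℝ r f (Set.Ici 0) := by
  refine contDiffOn_Ici_of_tendsto_iteratedDeriv r hc hf fun j hj hjr => ?_
  have hdiff : ∀ x, 0 < x → DifferentiableAt ℝ (iteratedDeriv j f) x := fun x hx =>
    (hf x hx).differentiableAt_iteratedDeriv j
  have hmono : MonotoneOn (iteratedDeriv j f) (Set.Ioi 0) := by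
    apply monotoneOn_of_deriv_nonneg (convex_Ioi 0)
    · exact fun x hx => (hdiff x hx).continuousAt.continuousWithinAt
    · rw [interior_Ioi]
      exact fun x hx => (hdiff x hx).differentiableWithinAt
    · rw [interior_Ioi]
      intro x hx
      rw [← iteratedDeriv_succ]
      exact hd (j + 1) (by omega) (by omega) x hx
  exact ⟨_, hmono.tendsto_nhdsGT ⟨0, by rintro _ ⟨x, hx, rfl⟩; exact hd j hj (by omega) x hx⟩⟩

/-! ### Powers in a Banach algebra by the binomial series -/

section BinomialSeries

theorem summable_abs_choose_mul_pow (q : ℝ) {ρ : ℝ} (h0 : 0 ≤ ρ) (h1 : ρ < 1) :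
    Summable fun k : ℕ => |Ring.choose q k| * ρ ^ k := by
  lift ρ to NNReal using h0
  have h2 : (ρ : ENNReal) < (binomialSeries ℝ q).radius :=
    lt_of_lt_of_le (by exact_mod_cast h1) binomialSeries_radius_ge_one
  simpa [binomialSeries] using (binomialSeries ℝ q).summable_norm_mul_pow h2

/-- The coefficient form of the rule that (1 + x)^(q+1) has derivative (q + 1)(1 + x)^q. -/
theorem succ_mul_choose_succ (q : ℝ) (k : ℕ) :
    ((k : ℝ) + 1) * Ring.choose (q + 1) (k + 1) = (q + 1) * Ring.choose q k := by
  have := Ring.choose_smul_choose (q + 1) (n := k + 1) (k := 1) (by omega)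
  simpa [Ring.choose_one_right] using this

theorem norm_pow_mul_le {𝔸 : Type*} [NormedRing 𝔸] (a v : 𝔸) (k : ℕ) : ‖a ^ k * v‖ ≤ ‖a‖ ^ k * ‖v‖ := by
  induction k with
  | zero => simp
  | succ k ih =>
    rw [pow_succ', mul_assoc, pow_succ', mul_assoc]
    exact (norm_mul_le _ _).trans (by gcongr)

variable {𝔸 : Type*} [NormedRing 𝔸] [NormedAlgebra ℝ 𝔸]

/-- The real power `(1 + x) ^ q` in a Banach algebra, for `‖x‖ < 1`, as a binomial series. -/
noncomputable def oneAddRpow (q : ℝ) (x : 𝔸) : 𝔸 := ∑' k : ℕ, Ring.choose q k • x ^ k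

theorem one_le_radius_binomialSeries (q : ℝ) : 1 ≤ (binomialSeries 𝔸 q).radius := by
  refine ENNReal.le_of_forall_nnreal_lt fun ρ hρ => ?_
  refine FormalMultilinearSeries.le_radius_of_summable _ ?_
  rw [← summable_nat_add_iff 1]
  refine Summable.of_nonneg_of_le (fun k => by positivity) (fun k => ?_)
    ((summable_nat_add_iff 1).2 (summable_abs_choose_mul_pow q ρ.2 (by exact_mod_cast hρ)))
  exact mul_le_mul_of_nonneg_right
    (FormalMultilinearSeries.ofScalars_norm_le 𝔸 _ _ (by omega)) (by positivity)

/-- Derivative of the trace of a power. -/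
theorem hasDerivAt_trace_pow {τ : 𝔸 →L[ℝ] ℝ} (hτ : ∀ x y, τ (x * y) = τ (y * x)) (x v : 𝔸) (k : ℕ)
    (t : ℝ) :
    HasDerivAt (fun t : ℝ => τ ((x + t • v) ^ (k + 1)))
      ((k + 1) * τ ((x + t • v) ^ k * v)) t := by
  have h1 : HasDerivAt (fun t : ℝ => x + t • v) v t := by
    simpa using ((hasDerivAt_id t).smul_const v).const_add x
  have h2 := τ.hasFDerivAt.comp_hasDerivAt t (h1.fun_pow' (k + 1))
  refine h2.congr_deriv ?_
  symm
  rw [map_sum, Finset.sum_congr rfl (g := fun _ => τ ((x + t • v) ^ k * v))]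
  · simp
  · intro i hi
    rw [Finset.mem_range] at hi
    rw [hτ, ← mul_assoc, ← pow_add]
    congr 3
    simp only [Nat.pred_eq_sub_one]
    omega

variable [CompleteSpace 𝔸]

theorem summable_choose_smul_pow (q : ℝ) {x : 𝔸} (hx : ‖x‖ < 1) :
    Summable fun k : ℕ => Ring.choose q k • x ^ k := by
  refine Summable.of_norm_bounded
    ((summable_abs_choose_mul_pow q (norm_nonneg x) hx).mul_right ‖(1 : 𝔸)‖) fun k => ?_
  rw [norm_smul, Real.norm_eq_abs, mul_assoc]
  gcongr
  simpa using norm_pow_mul_le x 1 k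

theorem analyticAt_oneAddRpow (q : ℝ) {x : 𝔸} (hx : ‖x‖ < 1) :
    AnalyticAt ℝ (oneAddRpow q : 𝔸 → 𝔸) x := by
  have hr := one_le_radius_binomialSeries (𝔸 := 𝔸) q
  have h := (binomialSeries 𝔸 q).hasFPowerSeriesOnBall (lt_of_lt_of_le one_pos hr)
  have heq : (binomialSeries 𝔸 q).sum = oneAddRpow q := by
    ext y
    exact FormalMultilinearSeries.ofScalars_sum_eq _ y
  rw [heq] at h
  refine h.analyticAt_of_mem (Metric.eball_subset_eball hr ?_)
  rw [mem_eball_zero_iff, ← ofReal_norm, ENNReal.ofReal_lt_one]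
  exact hx

theorem one_add_mul_oneAddRpow (q : ℝ) {x : 𝔸} (hx : ‖x‖ < 1) :
    (1 + x) * oneAddRpow q x = oneAddRpow (q + 1) x := by
  have h1 := summable_choose_smul_pow q hx
  have h2 := summable_choose_smul_pow (q + 1) hx
  have h3 : Summable fun k : ℕ => Ring.choose q k • x ^ (k + 1) := by
    simpa [pow_succ', mul_smul_comm] using h1.mul_left x
  rw [add_mul, one_mul, oneAddRpow, oneAddRpow, ← h1.tsum_mul_left, h2.tsum_eq_zero_add]
  conv_lhs => rw [h1.tsum_eq_zero_add]
  simp only [mul_smul_comm, ← pow_succ', Ring.choose_succ_succ, add_smul]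
  rw [h3.tsum_add ((summable_nat_add_iff 1).2 h1)]
  simp only [Ring.choose_zero_right]
  abel

theorem oneAddRpow_units_conj (q : ℝ) (u : 𝔸ˣ) {x : 𝔸} (hx : ‖x‖ < 1) :
    oneAddRpow q (u * x * ↑u⁻¹) = u * oneAddRpow q x * ↑u⁻¹ := by
  have h := summable_choose_smul_pow q hx
  rw [oneAddRpow, oneAddRpow, ← h.tsum_mul_left, ← (h.mul_left (u : 𝔸)).tsum_mul_right]
  refine tsum_congr fun k => ?_
  rw [Units.conj_pow]
  simp

/-- Under a trace, powers differentiate as if everything commuted, so the scalar computation applies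
term by term; a radius ρ < 1 gives the uniform summable bound. -/
theorem hasDerivAt_trace_oneAddRpow_line {τ : 𝔸 →L[ℝ] ℝ} (hτ : ∀ x y, τ (x * y) = τ (y * x))
    (q : ℝ) {x : 𝔸} (hx : ‖x‖ < 1) (v : 𝔸) :
    HasDerivAt (fun t : ℝ => τ (oneAddRpow (q + 1) (x + t • v)))
      ((q + 1) * τ (oneAddRpow q x * v)) 0 := by
  obtain ⟨ρ, hxρ, hρ⟩ := exists_between hx
  have hρ0 : 0 ≤ ρ := (norm_nonneg x).trans hxρ.le
  have hcont : ContinuousAt (fun t : ℝ => ‖x + t • v‖) 0 := by fun_prop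
  obtain ⟨ε, hε, hball⟩ := Metric.eventually_nhds_iff_ball.1
    (hcont.eventually_lt_const (show ‖x + (0 : ℝ) • v‖ < ρ by simpa using hxρ))
  have hτsum : ∀ t ∈ Metric.ball (0 : ℝ) ε, τ (oneAddRpow (q + 1) (x + t • v)) =
      Ring.choose (q + 1) 0 * τ 1 +
        ∑' k : ℕ, Ring.choose (q + 1) (k + 1) * τ ((x + t • v) ^ (k + 1)) := by
    intro t ht
    have hs := summable_choose_smul_pow (q + 1) ((hball t ht).trans hρ)
    rw [oneAddRpow, hs.tsum_eq_zero_add, map_add, τ.map_tsum ((summable_nat_add_iff 1).2 hs)]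
    simp
  have hsum := ((summable_abs_choose_mul_pow q hρ0 hρ).mul_left |q + 1|).mul_right (‖τ‖ * ‖v‖)
  have hsum0 : Summable fun k : ℕ =>
      Ring.choose (q + 1) (k + 1) * τ ((x + (0 : ℝ) • v) ^ (k + 1)) := by
    have hs := summable_choose_smul_pow (q + 1) hx
    simpa using (summable_nat_add_iff 1).2 (hs.map τ τ.continuous)
  have h0 : (0 : ℝ) ∈ Metric.ball (0 : ℝ) ε := Metric.mem_ball_self hε
  have hder : HasDerivAt
      (fun t : ℝ => ∑' k : ℕ, Ring.choose (q + 1) (k + 1) * τ ((x + t • v) ^ (k + 1)))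
      (∑' k : ℕ, (q + 1) * Ring.choose q k * τ ((x + (0 : ℝ) • v) ^ k * v)) 0 := by
    refine hasDerivAt_tsum_of_isPreconnected
      (g := fun k t => Ring.choose (q + 1) (k + 1) * τ ((x + t • v) ^ (k + 1)))
      (g' := fun k t => (q + 1) * Ring.choose q k * τ ((x + t • v) ^ k * v))
      hsum Metric.isOpen_ball (convex_ball (0 : ℝ) ε).isPreconnected
      (fun k t _ => ?_) (fun k t ht => ?_) h0 hsum0 h0
    · refine ((hasDerivAt_trace_pow hτ x v k t).const_mul
        (Ring.choose (q + 1) (k + 1))).congr_deriv ?_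
      rw [← succ_mul_choose_succ]
      ring
    · calc ‖(q + 1) * Ring.choose q k * τ ((x + t • v) ^ k * v)‖
          = |q + 1| * |Ring.choose q k| * ‖τ ((x + t • v) ^ k * v)‖ := by
            rw [norm_mul, norm_mul, Real.norm_eq_abs, Real.norm_eq_abs]
        _ ≤ |q + 1| * |Ring.choose q k| * (‖τ‖ * (ρ ^ k * ‖v‖)) := by
            refine mul_le_mul_of_nonneg_left ((τ.le_opNorm _).trans ?_) (by positivity)
            refine mul_le_mul_of_nonneg_left ((norm_pow_mul_le _ _ _).trans ?_) (norm_nonneg _)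
            exact mul_le_mul_of_nonneg_right
              (pow_le_pow_left₀ (norm_nonneg _) (hball t ht).le k) (norm_nonneg _)
        _ = |q + 1| * (|Ring.choose q k| * ρ ^ k) * (‖τ‖ * ‖v‖) := by ring
  have hval : (∑' k : ℕ, (q + 1) * Ring.choose q k * τ ((x + (0 : ℝ) • v) ^ k * v)) =
      (q + 1) * τ (oneAddRpow q x * v) := by
    have hs := summable_choose_smul_pow q hx
    rw [oneAddRpow, ← hs.tsum_mul_right, τ.map_tsum (hs.mul_right v), ← tsum_mul_left]
    refine tsum_congr fun k => ?_
    simp [mul_assoc]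
  rw [hval] at hder
  refine (hder.const_add (Ring.choose (q + 1) 0 * τ 1)).congr_of_eventuallyEq ?_
  filter_upwards [Metric.ball_mem_nhds 0 hε] with t ht using hτsum t ht

/-- Analyticity provides a Fréchet derivative, and its value on `X'` is read off along the straight
line in that direction. -/
theorem hasDerivAt_trace_oneAddRpow {τ : 𝔸 →L[ℝ] ℝ} (hτ : ∀ x y, τ (x * y) = τ (y * x))
    (q : ℝ) {X : ℝ → 𝔸} {X' : 𝔸} {t : ℝ} (hX : HasDerivAt X X' t) (hx : ‖X t‖ < 1) :
    HasDerivAt (fun t : ℝ => τ (oneAddRpow (q + 1) (X t)))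
      ((q + 1) * τ (oneAddRpow q (X t) * X')) t := by
  have hd : DifferentiableAt ℝ (fun y => τ (oneAddRpow (q + 1) y)) (X t) :=
    τ.differentiableAt.comp _ (analyticAt_oneAddRpow (q + 1) hx).differentiableAt
  have h1 : HasDerivAt (fun s : ℝ => X t + s • X') X' 0 := by
    simpa using ((hasDerivAt_id (0 : ℝ)).smul_const X').const_add (X t)
  have hd' : HasFDerivAt (fun y => τ (oneAddRpow (q + 1) y))
      (fderiv ℝ (fun y => τ (oneAddRpow (q + 1) y)) (X t)) (X t + (0 : ℝ) • X') := by
    simpa using hd.hasFDerivAt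
  have h2 := hd'.comp_hasDerivAt (0 : ℝ) h1
  rw [← HasDerivAt.unique h2 (hasDerivAt_trace_oneAddRpow_line hτ q hx X')]
  exact hd.hasFDerivAt.comp_hasDerivAt t hX

end BinomialSeries

/-! ### Commuting directional derivatives -/

section DirectionalDerivative

open scoped ContDiff Topology

variable {E : Type*} [NormedAddCommGroup E] [NormedSpace ℝ E]

/-- The derivative of `V` in the direction `e`. -/
noncomputable def dirDeriv (e : E) (V : E → ℝ) : E → ℝ := fun z => fderiv ℝ V z e

theorem dirDeriv_congr {Ω : Set E} (hΩ : IsOpen Ω) (e : E) {V V' : E → ℝ} (h : Set.EqOn V V' Ω) :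
    Set.EqOn (dirDeriv e V) (dirDeriv e V') Ω := fun z hz => by
  rw [dirDeriv, dirDeriv, (h.eventuallyEq_of_mem (hΩ.mem_nhds hz)).fderiv_eq]

theorem dirDeriv_iterate_congr {Ω : Set E} (hΩ : IsOpen Ω) (e : E) {V V' : E → ℝ}
    (h : Set.EqOn V V' Ω) (r : ℕ) :
    Set.EqOn ((dirDeriv e)^[r] V) ((dirDeriv e)^[r] V') Ω := by
  induction r with
  | zero => exact h
  | succ r ih =>
    simp only [Function.iterate_succ_apply']
    exact dirDeriv_congr hΩ e ih

theorem dirDeriv_const_smul (e : E) (c : ℝ) (V : E → ℝ) :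
    dirDeriv e (c • V) = c • dirDeriv e V := by
  ext z
  simp [dirDeriv, fderiv_const_smul_field]

theorem dirDeriv_iterate_const_smul (e : E) (c : ℝ) (V : E → ℝ) (r : ℕ) :
    (dirDeriv e)^[r] (c • V) = c • (dirDeriv e)^[r] V := by
  induction r with
  | zero => rfl
  | succ r ih => simp only [Function.iterate_succ_apply', ih, dirDeriv_const_smul]

theorem contDiffOn_dirDeriv {Ω : Set E} (hΩ : IsOpen Ω) (e : E) {V : E → ℝ}
    (hV : ContDiffOn ℝ ∞ V Ω) : ContDiffOn ℝ ∞ (dirDeriv e V) Ω :=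
  (hV.fderiv_of_isOpen hΩ (by simp)).clm_apply contDiffOn_const

theorem contDiffOn_dirDeriv_iterate {Ω : Set E} (hΩ : IsOpen Ω) (e : E) {V : E → ℝ}
    (hV : ContDiffOn ℝ ∞ V Ω) (r : ℕ) : ContDiffOn ℝ ∞ ((dirDeriv e)^[r] V) Ω := by
  induction r with
  | zero => exact hV
  | succ r ih =>
    rw [Function.iterate_succ_apply']
    exact contDiffOn_dirDeriv hΩ e ih

theorem dirDeriv_comm {Ω : Set E} (hΩ : IsOpen Ω) (e e' : E) {V : E → ℝ}
    (hV : ContDiffOn ℝ ∞ V Ω) :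
    Set.EqOn (dirDeriv e (dirDeriv e' V)) (dirDeriv e' (dirDeriv e V)) Ω := by
  intro z hz
  have hz' : ContDiffAt ℝ ∞ V z := hV.contDiffAt (hΩ.mem_nhds hz)
  have hd : DifferentiableAt ℝ (fderiv ℝ V) z :=
    (hz'.fderiv_right (m := ∞) (by simp)).differentiableAt (by simp)
  have key : ∀ u v : E, dirDeriv u (dirDeriv v V) z = fderiv ℝ (fderiv ℝ V) z u v := by
    intro u v
    change fderiv ℝ (fun y => fderiv ℝ V y v) z u = _
    rw [fderiv_clm_apply hd (differentiableAt_const v)]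
    simp
  rw [key, key]
  exact ((contDiffAt_infty.1 hz' 2).isSymmSndFDerivAt (by simp)).eq e e'

theorem dirDeriv_iterate_comm {Ω : Set E} (hΩ : IsOpen Ω) (e e' : E) {V : E → ℝ}
    (hV : ContDiffOn ℝ ∞ V Ω) (r : ℕ) :
    Set.EqOn ((dirDeriv e)^[r] (dirDeriv e' V)) (dirDeriv e' ((dirDeriv e)^[r] V)) Ω := by
  induction r with
  | zero => exact fun _ _ => rfl
  | succ r ih =>
    simp only [Function.iterate_succ_apply']
    exact (dirDeriv_congr hΩ e ih).trans
      (dirDeriv_comm hΩ e e' (contDiffOn_dirDeriv_iterate hΩ e hV r))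

theorem iteratedDeriv_comp_line {Ω : Set E} (hΩ : IsOpen Ω) (e z : E) {V : E → ℝ}
    (hV : ContDiffOn ℝ ∞ V Ω) (r : ℕ) {t : ℝ} (ht : z + t • e ∈ Ω) :
    iteratedDeriv r (fun s : ℝ => V (z + s • e)) t = (dirDeriv e)^[r] V (z + t • e) := by
  induction r generalizing t with
  | zero => simp
  | succ r ih =>
    have hline : HasDerivAt (fun s : ℝ => z + s • e) e t := by
      simpa using ((hasDerivAt_id t).smul_const e).const_add z
    have hev : iteratedDeriv r (fun s : ℝ => V (z + s • e)) =ᶠ[𝓝 t]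
        fun s => (dirDeriv e)^[r] V (z + s • e) := by
      filter_upwards [hline.continuousAt.eventually_mem (hΩ.mem_nhds ht)] with s hs using ih hs
    have hd := ((contDiffOn_dirDeriv_iterate hΩ e hV r).contDiffAt
      (hΩ.mem_nhds ht)).differentiableAt (by simp)
    rw [iteratedDeriv_succ, hev.deriv_eq, Function.iterate_succ_apply']
    exact (hd.hasFDerivAt.comp_hasDerivAt t hline).deriv

theorem dirDeriv_eq_of_hasDerivAt {e z : E} {V : E → ℝ} (hV : DifferentiableAt ℝ V z) {d : ℝ}
    (h : HasDerivAt (fun t : ℝ => V (z + t • e)) d 0) : dirDeriv e V z = d := by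
  have hline : HasDerivAt (fun s : ℝ => z + s • e) e 0 := by
    simpa using ((hasDerivAt_id (0 : ℝ)).smul_const e).const_add z
  have hV' : HasFDerivAt V (fderiv ℝ V z) (z + (0 : ℝ) • e) := by simpa using hV.hasFDerivAt
  exact HasDerivAt.unique (hV'.comp_hasDerivAt (0 : ℝ) hline) h

/-- Each derivative along `e` is traded for one along `e'` at the price of raising the index;
commutation of mixed derivatives lets the remaining ones be traded in turn. -/
theorem dirDeriv_iterate_eq_of_recurrence {Ω : Set E} (hΩ : IsOpen Ω) (e e' : E) {U : ℕ → E → ℝ}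
    (hU : ∀ j, ContDiffOn ℝ ∞ (U j) Ω) (c : ℕ → ℝ)
    (h : ∀ j, Set.EqOn (dirDeriv e (U j)) (c j • dirDeriv e' (U (j + 1))) Ω) (r j : ℕ) :
    Set.EqOn ((dirDeriv e)^[r] (U j))
      ((∏ i ∈ Finset.range r, c (j + i)) • (dirDeriv e')^[r] (U (j + r))) Ω := by
  induction r generalizing j with
  | zero => intro z _; simp
  | succ r ih =>
    rw [Function.iterate_succ_apply]
    refine (dirDeriv_iterate_congr hΩ e (h j) r).trans ?_
    rw [dirDeriv_iterate_const_smul]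
    intro z hz
    have h1 := dirDeriv_iterate_comm hΩ e e' (hU (j + 1)) r hz
    have h2 := dirDeriv_congr hΩ e' (ih (j + 1)) hz
    rw [Pi.smul_apply, h1, h2, dirDeriv_const_smul, Finset.prod_range_succ',
      Function.iterate_succ_apply']
    simp only [Pi.smul_apply, smul_eq_mul, add_zero]
    rw [show j + 1 + r = j + (r + 1) by ring, mul_left_comm, ← mul_assoc]
    simp only [show ∀ i, j + 1 + i = j + (i + 1) by intro i; ring]

end DirectionalDerivative

/-! ### Lagrange inversion for traces of powers -/

section LagrangeInversion

open scoped ContDiff Topology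

variable {𝔸 : Type*} [NormedRing 𝔸] [NormedAlgebra ℝ 𝔸] [CompleteSpace 𝔸]

theorem hasDerivAt_ringInverse_add_smul {x : 𝔸} (hx : IsUnit x) (b : 𝔸) :
    HasDerivAt (fun t : ℝ => Ring.inverse (x + t • b)) (-(Ring.inverse x * b * Ring.inverse x)) 0 := by
  obtain ⟨u, rfl⟩ := hx
  have hline : HasDerivAt (fun t : ℝ => (u : 𝔸) + t • b) b 0 := by
    simpa using ((hasDerivAt_id (0 : ℝ)).smul_const b).const_add (u : 𝔸)
  have h : HasFDerivAt Ring.inverse (-ContinuousLinearMap.mulLeftRight ℝ 𝔸 ↑u⁻¹ ↑u⁻¹)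
      ((u : 𝔸) + (0 : ℝ) • b) := by
    simpa using hasFDerivAt_ringInverse (𝕜 := ℝ) u
  refine (h.comp_hasDerivAt (0 : ℝ) hline).congr_deriv ?_
  simp

/-- A Lagrange inversion formula for traces of powers: the derivatives of the trace of
`((1 + l b)⁻¹ a) ^ q` are, up to a factor, those of the trace of `(a + s b) ^ (q + r)`. -/
theorem iteratedDeriv_trace_oneAddRpow_inverse_mul {τ : 𝔸 →L[ℝ] ℝ}
    (hτ : ∀ x y, τ (x * y) = τ (y * x)) {q : ℝ} (hq : 0 < q) {a : 𝔸} (ha : ‖a - 1‖ < 1) (b : 𝔸)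
    (r : ℕ) :
    iteratedDeriv r (fun l : ℝ => τ (oneAddRpow q (Ring.inverse (1 + l • b) * a - 1))) 0 =
      (-1) ^ r * (q / (q + r)) *
        iteratedDeriv r (fun s : ℝ => τ (oneAddRpow (q + r) (a + s • b - 1))) 0 := by
  -- With z = (s, l), the line s = 0 gives the left side of the formula and the line l = 0 the right
  -- side.
  set W : ℝ × ℝ → 𝔸 := fun z => Ring.inverse (1 + z.2 • b) * (a + z.1 • b) with hW
  set Ω₀ : Set (ℝ × ℝ) := {z | IsUnit (1 + z.2 • b)} with hΩ₀
  have hΩ₀o : IsOpen Ω₀ := Units.isOpen.preimage (f := fun z : ℝ × ℝ => 1 + z.2 • b) (by fun_prop)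
  have hWs : ContDiffOn ℝ ∞ W Ω₀ := by
    intro z hz
    obtain ⟨u, hu⟩ := hz
    have h1 : ContDiffAt ℝ ∞ (Ring.inverse : 𝔸 → 𝔸) (1 + z.2 • b) := by
      rw [← hu]
      exact contDiffAt_ringInverse ℝ u
    have h2 : ContDiffAt ℝ ∞ (fun z : ℝ × ℝ => Ring.inverse (1 + z.2 • b)) z :=
      h1.comp z (f := fun z : ℝ × ℝ => 1 + z.2 • b) (by fun_prop)
    have h3 : ContDiffAt ℝ ∞ (fun z : ℝ × ℝ => a + z.1 • b) z := by fun_prop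
    exact (h2.mul h3).contDiffWithinAt
  set Ω : Set (ℝ × ℝ) := Ω₀ ∩ W ⁻¹' Metric.ball 1 1 with hΩdef
  have hΩ : IsOpen Ω := hWs.continuousOn.isOpen_inter_preimage hΩ₀o Metric.isOpen_ball
  have hnorm : ∀ z ∈ Ω, ‖W z - 1‖ < 1 := fun z hz => by simpa [dist_eq_norm] using hz.2
  set U : ℕ → ℝ × ℝ → ℝ := fun j z => τ (oneAddRpow (q + j) (W z - 1)) with hU
  have hUs : ∀ j, ContDiffOn ℝ ∞ (U j) Ω := by
    intro j z hz
    have h1 : ContDiffAt ℝ ∞ (oneAddRpow (q + j) : 𝔸 → 𝔸) (W z - 1) :=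
      (analyticAt_oneAddRpow (q + j) (hnorm z hz)).contDiffAt
    have h2 : ContDiffAt ℝ ∞ (fun z => W z - 1) z :=
      (hWs.contDiffAt (hΩ₀o.mem_nhds hz.1)).sub contDiffAt_const
    exact (τ.contDiff.contDiffAt.comp z (h1.comp z h2)).contDiffWithinAt
  -- Put R = (1 + l b)⁻¹. Then W has s-derivative R b and l-derivative -R b W; cyclicity of τ lets
  -- the extra factor W raise the exponent by one.
  have hrec : ∀ j : ℕ, Set.EqOn (dirDeriv ((0, 1) : ℝ × ℝ) (U j))
      ((-((q + j) / (q + j + 1))) • dirDeriv ((1, 0) : ℝ × ℝ) (U (j + 1))) Ω := by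
    intro j z hz
    have hdiff : ∀ i, DifferentiableAt ℝ (U i) z := fun i =>
      ((hUs i).contDiffAt (hΩ.mem_nhds hz)).differentiableAt (by simp)
    have hunit : IsUnit (1 + z.2 • b) := hz.1
    have hX1 : HasDerivAt (fun t : ℝ => W (z + t • ((1, 0) : ℝ × ℝ)) - 1)
        (Ring.inverse (1 + z.2 • b) * b) 0 := by
      have h1 : HasDerivAt (fun t : ℝ => a + (z.1 + t) • b) b 0 := by
        simpa using (((hasDerivAt_id (0 : ℝ)).const_add z.1).smul_const b).const_add a
      simpa [hW] using (h1.const_mul (Ring.inverse (1 + z.2 • b))).sub_const 1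
    have hX2 : HasDerivAt (fun t : ℝ => W (z + t • ((0, 1) : ℝ × ℝ)) - 1)
        (-(Ring.inverse (1 + z.2 • b) * b) * W z) 0 := by
      have h1 := (hasDerivAt_ringInverse_add_smul hunit b).mul_const (a + z.1 • b)
      have h2 : (fun t : ℝ => W (z + t • ((0, 1) : ℝ × ℝ)) - 1) =
          fun t : ℝ => Ring.inverse (1 + z.2 • b + t • b) * (a + z.1 • b) - 1 := by
        ext t
        simp [hW, add_smul, add_assoc]
      rw [h2]
      refine (h1.sub_const 1).congr_deriv ?_
      simp [hW, mul_assoc]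
    have hz0 : ∀ e : ℝ × ℝ, z + (0 : ℝ) • e = z := by simp
    have hD1 := dirDeriv_eq_of_hasDerivAt (hdiff (j + 1)) (by
      have := hasDerivAt_trace_oneAddRpow hτ (q + j) hX1 (by rw [hz0]; exact hnorm z hz)
      simpa only [hU, Nat.cast_add, Nat.cast_one, add_assoc] using this)
    have hD2 := dirDeriv_eq_of_hasDerivAt (hdiff j) (by
      have := hasDerivAt_trace_oneAddRpow hτ (q + j - 1) hX2 (by rw [hz0]; exact hnorm z hz)
      simpa only [hU, sub_add_cancel] using this)
    have hW1 : W z * oneAddRpow (q + j - 1) (W z - 1) = oneAddRpow (q + j) (W z - 1) := by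
      simpa using one_add_mul_oneAddRpow (q + j - 1) (hnorm z hz)
    rw [hz0] at hD1 hD2
    rw [Pi.smul_apply, hD1, hD2, ← mul_assoc, hτ, ← mul_assoc, hW1, mul_neg, map_neg, smul_eq_mul]
    have : q + (j : ℝ) + 1 ≠ 0 := by positivity
    field_simp
    ring
  have hmem : ((0, 0) : ℝ × ℝ) ∈ Ω := by
    refine ⟨by simp [hΩ₀], ?_⟩
    simpa [hW, dist_eq_norm] using ha
  have hmain := dirDeriv_iterate_eq_of_recurrence hΩ (0, 1) (1, 0) hUs _ hrec r 0 hmem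
  -- The product telescopes.
  have hprod : ∏ i ∈ Finset.range r, (-((q + ((0 + i : ℕ) : ℝ)) / (q + ((0 + i : ℕ) : ℝ) + 1))) =
      (-1) ^ r * (q / (q + r)) := by
    clear hmain
    induction r with
    | zero => simp [hq.ne']
    | succ r ih =>
      have h1 : q + (r : ℝ) ≠ 0 := by positivity
      have h2 : q + (r : ℝ) + 1 ≠ 0 := by positivity
      rw [Finset.prod_range_succ, ih]
      push_cast
      rw [zero_add, ← add_assoc]
      field_simp
      ring
  rw [hprod] at hmain
  have hl := iteratedDeriv_comp_line hΩ ((0, 1) : ℝ × ℝ) (0, 0) (hUs 0) r (t := 0) (by simpa using hmem)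
  have hs := iteratedDeriv_comp_line hΩ ((1, 0) : ℝ × ℝ) (0, 0) (hUs (0 + r)) r (t := 0)
    (by simpa using hmem)
  simp only [hU, hW, Prod.smul_mk, Prod.mk_add_mk, smul_eq_mul, mul_zero, mul_one, zero_add,
    add_zero, zero_smul, Nat.cast_zero, Ring.inverse_one, one_mul, Pi.smul_apply] at hl hs hmain
  rw [hl, hs, hmain]

end LagrangeInversion

/-! ### Eigenvalues, the functional calculus and smoothness at positive definite points -/

section Spectral

variable {n : ℕ}

theorem Matrix.IsHermitian.cfc_smul {M : Matrix (Fin n) (Fin n) ℂ} (hM : M.IsHermitian) (c : ℝ)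
    (f : ℝ → ℝ) : cfc f (c • M) = cfc (fun x => f (c * x)) M :=
  (cfc_comp_const_mul c f M ((M.finite_real_spectrum.image _).continuousOn f) hM).symm

theorem Matrix.IsHermitian.re_trace_cfc {M : Matrix (Fin n) (Fin n) ℂ}
    (hM : M.IsHermitian) (f : ℝ → ℝ) : (cfc f M).trace.re = ∑ i, f (hM.eigenvalues i) := by
  rw [hM.cfc_eq, Matrix.IsHermitian.cfc, Unitary.conjStarAlgAut_apply, Matrix.trace_mul_comm,
    ← mul_assoc]
  simp [Matrix.trace]

theorem tracePow_eq_sum {A B : Matrix (Fin n) (Fin n) ℂ} {l : ℝ} (h : (A + l • B).IsHermitian)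
    (p : ℝ) : tracePow A B p l = ∑ i, h.eigenvalues i ^ p :=
  h.re_trace_cfc _

theorem isHermitian_add_smul {A B : Matrix (Fin n) (Fin n) ℂ} (hA : A.IsHermitian)
    (hB : B.IsHermitian) (l : ℝ) : (A + l • B).IsHermitian :=
  hA.add (by rw [Matrix.IsHermitian, Matrix.conjTranspose_smul, hB.eq, star_trivial])

theorem Matrix.PosSemidef.add_smul {A B : Matrix (Fin n) (Fin n) ℂ} (hA : A.PosSemidef)
    (hB : B.PosSemidef) {l : ℝ} (hl : 0 ≤ l) : (A + l • B).PosSemidef :=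
  Matrix.PosSemidef.add hA (hB.smul hl)

theorem Matrix.PosDef.add_smul {A B : Matrix (Fin n) (Fin n) ℂ} (hA : A.PosDef)
    (hB : B.PosSemidef) {l : ℝ} (hl : 0 ≤ l) : (A + l • B).PosDef :=
  Matrix.PosDef.add_posSemidef hA (hB.smul hl)

/-- If `A + l B` is positive definite for one `l ≥ 0`, then for all `l > 0`. -/
theorem Matrix.PosDef.add_smul_of_add_smul {A B : Matrix (Fin n) (Fin n) ℂ} (hA : A.PosSemidef)
    (hB : B.PosSemidef) {l l' : ℝ} (h : (A + l • B).PosDef) (hl' : 0 < l') :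
    (A + l' • B).PosDef := by
  rcases le_total l l' with hle | hle
  · have : A + l' • B = (A + l • B) + (l' - l) • B := by rw [sub_smul]; abel
    rw [this]
    exact h.add_smul hB (by linarith)
  · have hl0 : 0 < l := hl'.trans_le hle
    have : A + l' • B = (l' / l) • (A + l • B) + (1 - l' / l) • A := by
      rw [smul_add, smul_smul, div_mul_cancel₀ _ hl0.ne', sub_smul, one_smul]
      abel
    rw [this]
    exact (h.smul (by positivity)).add_posSemidef
      (hA.smul (sub_nonneg.2 ((div_le_one hl0).2 hle)))

theorem tracePow_smul {A B : Matrix (Fin n) (Fin n) ℂ} (hA : A.PosSemidef)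
    (hB : B.PosSemidef) (p : ℝ) {c l : ℝ} (hc : 0 < c) (hl : 0 ≤ l) :
    tracePow (c • A) (c • B) p l = c ^ p * tracePow A B p l := by
  have h := hA.add_smul hB hl
  rw [tracePow_eq_sum h.1, tracePow, matrixPow, smul_comm l c B, ← smul_add, h.1.cfc_smul,
    h.1.re_trace_cfc, Finset.mul_sum]
  exact Finset.sum_congr rfl fun i _ => Real.mul_rpow hc.le (h.eigenvalues_nonneg i)

open scoped Matrix.Norms.L2Operator

/-- The real part of the trace, as a continuous linear functional. -/
noncomputable def traceRe (n : ℕ) : Matrix (Fin n) (Fin n) ℂ →L[ℝ] ℝ :=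
  LinearMap.toContinuousLinearMap
    { toFun := fun M => M.trace.re
      map_add' := fun M N => by simp
      map_smul' := fun c M => by simp [Matrix.trace_smul] }

theorem traceRe_apply (M : Matrix (Fin n) (Fin n) ℂ) : traceRe n M = M.trace.re := rfl

theorem traceRe_mul_comm (M N : Matrix (Fin n) (Fin n) ℂ) : traceRe n (M * N) = traceRe n (N * M) := by
  rw [traceRe_apply, traceRe_apply, Matrix.trace_mul_comm]

theorem Matrix.IsHermitian.norm_sub_smul_one {M : Matrix (Fin n) (Fin n) ℂ}
    (hM : M.IsHermitian) (c : ℝ) :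
    ‖M - c • (1 : Matrix (Fin n) (Fin n) ℂ)‖ = ‖fun i => ((hM.eigenvalues i - c : ℝ) : ℂ)‖ := by
  have hsa : IsSelfAdjoint M := hM
  have h1 : M - c • (1 : Matrix (Fin n) (Fin n) ℂ) = cfc (fun x : ℝ => x - c) M := by
    rw [cfc_sub .., cfc_id' .., cfc_const .., Algebra.algebraMap_eq_smul_one]
  rw [h1, hM.cfc_eq, Matrix.IsHermitian.cfc, Unitary.conjStarAlgAut_apply,
    ← Unitary.coe_star, CStarRing.norm_mul_coe_unitary, CStarRing.norm_coe_unitary_mul,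
    Matrix.l2_opNorm_diagonal]
  rfl

theorem Matrix.IsHermitian.norm_inv_smul_sub_one_lt_one_iff {M : Matrix (Fin n) (Fin n) ℂ}
    (hM : M.IsHermitian) {c : ℝ} (hc : 0 < c) :
    ‖c⁻¹ • M - 1‖ < 1 ↔ ∀ i, |hM.eigenvalues i - c| < c := by
  have h1 : c⁻¹ • M - 1 = c⁻¹ • (M - c • (1 : Matrix (Fin n) (Fin n) ℂ)) := by
    rw [smul_sub, smul_smul, inv_mul_cancel₀ hc.ne', one_smul]
  rw [h1, norm_smul, hM.norm_sub_smul_one, Real.norm_eq_abs, abs_of_pos (inv_pos.2 hc),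
    inv_mul_lt_iff₀ hc, mul_one, pi_norm_lt_iff hc]
  simp only [Complex.norm_real, Real.norm_eq_abs]

theorem Matrix.IsHermitian.norm_sub_one_lt_one_iff {M : Matrix (Fin n) (Fin n) ℂ}
    (hM : M.IsHermitian) : ‖M - 1‖ < 1 ↔ ∀ i, |hM.eigenvalues i - 1| < 1 := by
  simpa using hM.norm_inv_smul_sub_one_lt_one_iff one_pos

theorem Matrix.PosDef.exists_norm_inv_smul_sub_one_lt_one {M : Matrix (Fin n) (Fin n) ℂ}
    (hM : M.PosDef) : ∃ c : ℝ, 0 < c ∧ ‖c⁻¹ • M - 1‖ < 1 := by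
  -- Any c > 0 larger than half of each eigenvalue would do; the summand 1 keeps c positive for n =
  -- 0.
  refine ⟨1 + ∑ i, hM.1.eigenvalues i, ?_, ?_⟩
  · have := Finset.sum_nonneg fun i (_ : i ∈ Finset.univ) => (hM.eigenvalues_pos i).le
    linarith
  · have hs := Finset.sum_nonneg fun i (_ : i ∈ Finset.univ) => (hM.eigenvalues_pos i).le
    rw [hM.1.norm_inv_smul_sub_one_lt_one_iff (by linarith)]
    intro i
    have h1 := hM.eigenvalues_pos i
    have h2 := Finset.single_le_sum (f := hM.1.eigenvalues)
      (fun i _ => (hM.eigenvalues_pos i).le) (Finset.mem_univ i)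
    rw [abs_lt]
    constructor <;> linarith

theorem Real.hasSum_choose_mul_pow (q : ℝ) {x : ℝ} (hx : |x| < 1) :
    HasSum (fun k : ℕ => Ring.choose q k * x ^ k) ((1 + x) ^ q) := by
  have h := (Real.one_add_rpow_hasFPowerSeriesOnBall_zero (a := q)).hasSum (y := x) (by
    rw [mem_eball_zero_iff, ← ofReal_norm, ENNReal.ofReal_lt_one]
    exact hx)
  simpa [binomialSeries, mul_comm] using h

theorem Matrix.IsHermitian.traceRe_oneAddRpow {M : Matrix (Fin n) (Fin n) ℂ}
    (hM : M.IsHermitian) (h : ‖M - 1‖ < 1) (q : ℝ) :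
    traceRe n (oneAddRpow q (M - 1)) = (cfc (fun x : ℝ => x ^ q) M).trace.re := by
  have hsa : IsSelfAdjoint M := hM
  have hev := hM.norm_sub_one_lt_one_iff.1 h
  have hpow : ∀ k : ℕ, traceRe n ((M - 1) ^ k) = ∑ i, (hM.eigenvalues i - 1) ^ k := by
    intro k
    rw [← hM.re_trace_cfc (fun x => (x - 1) ^ k), cfc_pow .., cfc_sub .., cfc_id' ..,
      cfc_const_one .., traceRe_apply]
  have h1 := (summable_choose_smul_pow q h).hasSum.mapL (traceRe n)
  have h2 : HasSum (fun k : ℕ => ∑ i, Ring.choose q k * (hM.eigenvalues i - 1) ^ k)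
      (∑ i, (1 + (hM.eigenvalues i - 1)) ^ q) :=
    hasSum_sum fun i _ => Real.hasSum_choose_mul_pow q (hev i)
  have h3 : (fun k : ℕ => traceRe n (Ring.choose q k • (M - 1) ^ k)) =
      fun k : ℕ => ∑ i, Ring.choose q k * (hM.eigenvalues i - 1) ^ k := by
    ext k
    rw [map_smul, hpow, smul_eq_mul, Finset.mul_sum]
  rw [hM.re_trace_cfc]
  rw [h3] at h1
  rw [oneAddRpow, h1.unique h2]
  simp

open scoped ContDiff Topology in
-- Dividing by a suitable c moves the matrix into the unit ball around 1, where the trace of the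
-- power is that of the analytic binomial series.
theorem contDiffAt_tracePow {A B : Matrix (Fin n) (Fin n) ℂ} (hA : A.IsHermitian)
    (hB : B.IsHermitian) (p : ℝ) {l : ℝ} (h : (A + l • B).PosDef) :
    ContDiffAt ℝ ∞ (tracePow A B p) l := by
  obtain ⟨c, hc, hlt⟩ := h.exists_norm_inv_smul_sub_one_lt_one
  set X : ℝ → Matrix (Fin n) (Fin n) ℂ := fun t => c⁻¹ • (A + t • B) - 1 with hX
  have hXs : ContDiffAt ℝ ∞ X l := by fun_prop
  have hY : ContDiffAt ℝ ∞ (oneAddRpow p : Matrix (Fin n) (Fin n) ℂ → _) (X l) :=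
    (analyticAt_oneAddRpow p hlt).contDiffAt
  have hs : ContDiffAt ℝ ∞ (fun t => c ^ p * traceRe n (oneAddRpow p (X t))) l :=
    contDiffAt_const.mul ((traceRe n).contDiff.contDiffAt.comp l (hY.comp l hXs))
  refine hs.congr_of_eventuallyEq ?_
  filter_upwards [hXs.continuousAt.norm.eventually_lt_const hlt] with t ht
  have hM := isHermitian_add_smul hA hB t
  have hM' : (c⁻¹ • (A + t • B)).IsHermitian := by
    rw [Matrix.IsHermitian, Matrix.conjTranspose_smul, hM.eq, star_trivial]
  rw [hX, hM'.traceRe_oneAddRpow ht, tracePow, matrixPow,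
    hM.cfc_smul, hM.re_trace_cfc, hM.re_trace_cfc, Finset.mul_sum]
  refine Finset.sum_congr rfl fun i _ => ?_
  have := (abs_lt.1 ((hM.norm_inv_smul_sub_one_lt_one_iff hc).1 ht i)).1
  rw [Real.mul_rpow (inv_nonneg.2 hc.le) (by linarith), ← mul_assoc, Real.inv_rpow hc.le,
    mul_inv_cancel₀ (Real.rpow_pos_of_pos hc p).ne', one_mul]

end Spectral

/-! ### From positive powers to negative powers -/

section PowerReciprocity

variable {n : ℕ}

theorem Matrix.PosDef.exists_isHermitian_isUnit_mul_self {A : Matrix (Fin n) (Fin n) ℂ}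
    (hA : A.PosDef) : ∃ S : Matrix (Fin n) (Fin n) ℂ, S.IsHermitian ∧ IsUnit S ∧ S * S = A := by
  have hsa : IsSelfAdjoint A := hA.1
  have hS : cfc Real.sqrt A * cfc Real.sqrt A = A := by
    rw [← cfc_mul Real.sqrt Real.sqrt A, cfc_congr (g := fun x : ℝ => x), cfc_id' ℝ A]
    intro x hx
    obtain ⟨i, rfl⟩ := (hA.1.spectrum_real_eq_range_eigenvalues ▸ hx : x ∈ Set.range _)
    exact Real.mul_self_sqrt (hA.eigenvalues_pos i).le
  refine ⟨cfc Real.sqrt A, cfc_predicate Real.sqrt A, ?_, hS⟩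
  have hu : IsUnit (cfc Real.sqrt A * cfc Real.sqrt A) := by rw [hS]; exact hA.isUnit
  exact ((Commute.refl _).isUnit_mul_iff.1 hu).1

theorem Matrix.IsHermitian.re_trace_cfc_rpow_inv {N : Matrix (Fin n) (Fin n) ℂ}
    (hN : N.IsHermitian) (hu : IsUnit N) (q : ℝ) (hpos : ∀ i, 0 < hN.eigenvalues i) :
    (cfc (fun x : ℝ => x ^ q) N).trace.re = (cfc (fun x : ℝ => x ^ (-q)) N⁻¹).trace.re := by
  obtain ⟨u, rfl⟩ := hu
  have hinv : cfc (fun x : ℝ => x⁻¹ ^ (-q)) (u : Matrix (Fin n) (Fin n) ℂ) =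
      cfc (fun x : ℝ => x ^ (-q)) ((u : Matrix (Fin n) (Fin n) ℂ))⁻¹ := by
    rw [← Matrix.coe_units_inv]
    exact cfc_comp_inv (fun x : ℝ => x ^ (-q)) u
      (((u : Matrix (Fin n) (Fin n) ℂ).finite_real_spectrum.image _).continuousOn _) hN
  rw [← hinv, hN.re_trace_cfc, hN.re_trace_cfc]
  refine Finset.sum_congr rfl fun i _ => ?_
  rw [Real.rpow_neg (inv_nonneg.2 (hpos i).le), Real.inv_rpow (hpos i).le, inv_inv]

open scoped Matrix.Norms.L2Operator Topology ContDiff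

/-- The derivatives of traces of positive powers of `A + l B` are, up to a factor, those of traces
of negative powers of another such line. -/
theorem exists_iteratedDeriv_tracePow_neg_eq {A B : Matrix (Fin n) (Fin n) ℂ} (hA : A.PosDef)
    (hB : B.PosSemidef) (h1 : ‖A - 1‖ < 1) {q : ℝ} (hq : 0 < q) :
    ∃ A' B' : Matrix (Fin n) (Fin n) ℂ, A'.PosDef ∧ B'.PosSemidef ∧ ∀ r : ℕ,
      iteratedDeriv r (tracePow A' B' (-q)) 0 =
        (-1) ^ r * (q / (q + r)) * iteratedDeriv r (tracePow A B (q + r)) 0 := by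
  obtain ⟨S, hS, hSu, hSS⟩ := hA.exists_isHermitian_isUnit_mul_self
  have hSi : S⁻¹.IsHermitian := hS.inv
  have hA' : (S⁻¹ * S⁻¹).PosDef := by
    rw [← Matrix.mul_inv_rev, hSS]
    exact hA.inv
  have hB' : (S⁻¹ * B * S⁻¹).PosSemidef := by
    have := hB.mul_mul_conjTranspose_same S⁻¹
    rwa [hSi.eq] at this
  -- These make A' + l B' the inverse of S (1 + l B)⁻¹ S, which is the conjugate by S of (1 + l B)⁻¹
  -- A because S² = A.
  refine ⟨S⁻¹ * S⁻¹, S⁻¹ * B * S⁻¹, hA', hB', fun r => ?_⟩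
  have key := iteratedDeriv_trace_oneAddRpow_inverse_mul (τ := traceRe n) traceRe_mul_comm hq h1 B r
  have hF : (fun s : ℝ => traceRe n (oneAddRpow (q + r) (A + s • B - 1))) =ᶠ[𝓝 0]
      tracePow A B (q + r) := by
    have hc : ContinuousAt (fun s : ℝ => ‖A + s • B - 1‖) 0 := by fun_prop
    filter_upwards [hc.eventually_lt_const (show ‖A + (0 : ℝ) • B - 1‖ < 1 by simpa using h1)]
      with s hs
    exact (isHermitian_add_smul hA.1 hB.1 s).traceRe_oneAddRpow hs _
  have hG : (fun l : ℝ => traceRe n (oneAddRpow q (Ring.inverse (1 + l • B) * A - 1))) =ᶠ[𝓝 0]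
      tracePow (S⁻¹ * S⁻¹) (S⁻¹ * B * S⁻¹) (-q) := by
    have hcu : ContinuousAt (fun l : ℝ => 1 + l • B) 0 := by fun_prop
    have hcinv : ContinuousAt (fun l : ℝ => Ring.inverse (1 + l • B)) 0 := by
      have : ContinuousAt (Ring.inverse : Matrix (Fin n) (Fin n) ℂ → _) (1 + (0 : ℝ) • B) := by
        simpa using NormedRing.inverse_continuousAt (1 : (Matrix (Fin n) (Fin n) ℂ)ˣ)
      exact ContinuousAt.comp (f := fun l : ℝ => 1 + l • B) this hcu
    have hcW : ContinuousAt (fun l : ℝ => ‖Ring.inverse (1 + l • B) * A - 1‖) 0 := by fun_prop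
    have hcN : ContinuousAt (fun l : ℝ => ‖S * Ring.inverse (1 + l • B) * S - 1‖) 0 := by fun_prop
    have hunit : ∀ᶠ l : ℝ in 𝓝 0, IsUnit (1 + l • B) :=
      hcu.eventually_mem (Units.isOpen.mem_nhds (by simp))
    filter_upwards [hunit, hcW.eventually_lt_const (u := 1) (by simpa using h1),
      hcN.eventually_lt_const (u := 1) (by simpa [hSS] using h1)] with l hu hW hN
    obtain ⟨v, hv⟩ := hSu
    have hinv : Ring.inverse (1 + l • B) = (1 + l • B)⁻¹ := by
      rw [Matrix.nonsing_inv_eq_ringInverse]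
    have hherm : (1 + l • B).IsHermitian := isHermitian_add_smul Matrix.isHermitian_one hB.1 l
    set N := S * Ring.inverse (1 + l • B) * S with hNdef
    have hNh : N.IsHermitian := by
      have := Matrix.isHermitian_mul_mul_conjTranspose S (hinv ▸ hherm.inv :
        (Ring.inverse (1 + l • B)).IsHermitian)
      rwa [hS.eq] at this
    have hdet : IsUnit (1 + l • B).det := (Matrix.isUnit_iff_isUnit_det _).1 hu
    have hNinv : N⁻¹ = S⁻¹ * S⁻¹ + l • (S⁻¹ * B * S⁻¹) := by
      rw [hNdef, Matrix.mul_inv_rev, Matrix.mul_inv_rev, hinv, Matrix.nonsing_inv_nonsing_inv _ hdet]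
      simp [mul_add, add_mul, mul_assoc]
    have hNu : IsUnit N := by
      rw [hNdef, hinv]
      refine (IsUnit.mul ?_ ?_).mul ?_
      · exact ⟨v, hv⟩
      · rw [Matrix.isUnit_iff_isUnit_det]
        exact Matrix.isUnit_nonsing_inv_det _ hdet
      · exact ⟨v, hv⟩
    have hconj : (v : Matrix (Fin n) (Fin n) ℂ) * (Ring.inverse (1 + l • B) * A - 1) *
        (↑v⁻¹ : Matrix (Fin n) (Fin n) ℂ) = N - 1 := by
      rw [mul_sub, sub_mul, mul_one, Units.mul_inv, hNdef, ← hSS, ← hv]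
      simp [mul_assoc]
    have h2 : traceRe n (oneAddRpow q (Ring.inverse (1 + l • B) * A - 1)) =
        traceRe n (oneAddRpow q (N - 1)) := by
      rw [← hconj, oneAddRpow_units_conj q v hW, traceRe_mul_comm, ← mul_assoc, Units.inv_mul,
        one_mul]
    have hpos : ∀ i, 0 < hNh.eigenvalues i := fun i => by
      have := (abs_lt.1 (hNh.norm_sub_one_lt_one_iff.1 hN i)).1
      linarith
    rw [h2, hNh.traceRe_oneAddRpow hN, hNh.re_trace_cfc_rpow_inv hNu q hpos, hNinv]
    rfl
  rw [← hF.iteratedDeriv_eq, ← hG.iteratedDeriv_eq]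
  exact key

end PowerReciprocity

/-! ### Complete monotonicity in terms of forward differences -/

section Differences

open MeasureTheory

theorem fwdDiff_iter_congr {f g : ℝ → ℝ} {l h : ℝ} (hh : 0 ≤ h) (r : ℕ)
    (hfg : ∀ x, l ≤ x → f x = g x) : (fwdDiff h)^[r] f l = (fwdDiff h)^[r] g l := by
  rw [fwdDiff_iter_eq_sum_shift, fwdDiff_iter_eq_sum_shift]
  refine Finset.sum_congr rfl fun k _ => ?_
  rw [hfg]
  have : 0 ≤ k • h := nsmul_nonneg hh k
  linarith

theorem fwdDiff_iter_integral {α : Type*} [MeasurableSpace α] {μ : Measure α} {G : ℝ → α → ℝ}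
    {l h : ℝ} (hh : 0 ≤ h) (r : ℕ) (hG : ∀ x, l ≤ x → Integrable (G x) μ) :
    (fwdDiff h)^[r] (fun x => ∫ t, G x t ∂μ) l = ∫ t, (fwdDiff h)^[r] (fun x => G x t) l ∂μ := by
  have hk : ∀ k : ℕ, l ≤ l + k • h := fun k => le_add_of_nonneg_right (nsmul_nonneg hh k)
  simp only [fwdDiff_iter_eq_sum_shift, zsmul_eq_mul]
  rw [integral_finsetSum _ fun k _ => (hG _ (hk k)).const_mul _]
  exact Finset.sum_congr rfl fun k _ => (integral_const_mul _ _).symm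

theorem fwdDiff_iter_exp (h s : ℝ) (r : ℕ) (l : ℝ) :
    (fwdDiff h)^[r] (fun x => Real.exp (-(x * s))) l =
      (Real.exp (-(h * s)) - 1) ^ r * Real.exp (-(l * s)) := by
  induction r generalizing l with
  | zero => simp
  | succ r ih =>
    rw [Function.iterate_succ_apply', fwdDiff, ih, ih, add_mul, neg_add, Real.exp_add]
    ring

theorem fwdDiff_iter_exp_nonneg {h s : ℝ} (hh : 0 ≤ h) (hs : 0 ≤ s) (r : ℕ) (l : ℝ) :
    0 ≤ (-1) ^ r * (fwdDiff h)^[r] (fun x => Real.exp (-(x * s))) l := by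
  rw [fwdDiff_iter_exp, ← mul_assoc, ← mul_pow]
  have : Real.exp (-(h * s)) ≤ 1 := Real.exp_le_one_iff.2 (by nlinarith)
  have : 0 ≤ -1 * (Real.exp (-(h * s)) - 1) := by linarith
  positivity

/-- The function is the integral over t > 0 of e^(-t) e^(-xbt), a positive mixture of decaying
exponentials in x. -/
theorem fwdDiff_iter_one_add_mul_inv_nonneg {b : ℝ} (hb : 0 ≤ b) {l h : ℝ} (hl : 0 ≤ l)
    (hh : 0 ≤ h) (r : ℕ) :
    0 ≤ (-1) ^ r * (fwdDiff h)^[r] (fun x => (1 + x * b)⁻¹) l := by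
  have hneg : ∀ x, l ≤ x → -(1 + x * b) < 0 := fun x hx => by
    have := mul_nonneg (hl.trans hx) hb
    linarith
  have hrep : ∀ x, l ≤ x → (1 + x * b)⁻¹ =
      ∫ t in Set.Ioi (0 : ℝ), Real.exp (-t) * Real.exp (-(x * (b * t))) := by
    intro x hx
    have h1 := integral_exp_mul_Ioi (hneg x hx) 0
    rw [mul_zero, Real.exp_zero, neg_div_neg_eq, one_div] at h1
    rw [← h1]
    congr 1
    ext t
    rw [← Real.exp_add]
    ring_nf
  rw [fwdDiff_iter_congr hh r hrep, fwdDiff_iter_integral hh r, ← integral_const_mul]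
  · refine setIntegral_nonneg measurableSet_Ioi fun t ht => ?_
    have h1 : (fun x : ℝ => Real.exp (-t) * Real.exp (-(x * (b * t)))) =
        Real.exp (-t) • fun x : ℝ => Real.exp (-(x * (b * t))) := rfl
    rw [h1, fwdDiff_iter_const_smul, Pi.smul_apply, smul_eq_mul, mul_left_comm]
    exact mul_nonneg (Real.exp_pos _).le
      (fwdDiff_iter_exp_nonneg hh (mul_nonneg hb (Set.mem_Ioi.1 ht).le) r l)
  · intro x hx
    refine (integrableOn_exp_mul_Ioi (hneg x hx) 0).congr_fun (fun t _ => ?_) measurableSet_Ioi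
    rw [← Real.exp_add]
    ring_nf

theorem IsLaplaceOfPositive.fwdDiff_iter_nonneg {f : ℝ → ℂ} (hf : IsLaplaceOfPositive f)
    {h : ℝ} (hh : 0 ≤ h) (r : ℕ) (l : ℝ) :
    0 ≤ (-1) ^ r * (fwdDiff h)^[r] (fun x => (f x).re) l := by
  obtain ⟨μ, hμ, hrep⟩ := hf
  have h1 : (fun x => (f x).re) = fun x => ∫ s, Real.exp (-(x * s)) ∂μ := by
    ext x
    rw [(hrep x).2, Complex.ofReal_re]
  rw [h1, fwdDiff_iter_integral hh r fun x _ => (hrep x).1, ← integral_const_mul]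
  refine integral_nonneg_of_ae ?_
  have : ∀ᵐ s ∂μ, s ∉ Set.Iio 0 := measure_eq_zero_iff_ae_notMem.1 hμ
  filter_upwards [this] with s hs
  exact fwdDiff_iter_exp_nonneg hh (not_lt.1 hs) r l

end Differences

/-! ### Negative powers from BMV by the Gamma integral -/

section NegativePowers

open MeasureTheory

variable {n : ℕ}

open scoped Matrix.Norms.L2Operator in
theorem Matrix.IsHermitian.re_trace_exp {M : Matrix (Fin n) (Fin n) ℂ} (hM : M.IsHermitian)
    (t : ℝ) : (NormedSpace.exp (t • M)).trace.re = ∑ i, Real.exp (t * hM.eigenvalues i) := by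
  have hsa : IsSelfAdjoint (t • M) := by
    rw [IsSelfAdjoint, star_smul, star_trivial]
    exact congrArg _ hM
  rw [← CFC.real_exp_eq_normedSpace_exp hsa, hM.cfc_smul, hM.re_trace_cfc]

theorem integrableOn_rpow_mul_exp_neg {q e : ℝ} (hq : 0 < q) (he : 0 < e) :
    IntegrableOn (fun t : ℝ => t ^ (q - 1) * Real.exp (-(e * t))) (Set.Ioi 0) := by
  have := integrableOn_rpow_mul_exp_neg_mul_rpow (p := 1) (s := q - 1) (b := e) (by linarith)
    one_pos he
  simpa using this

theorem fwdDiff_iter_tracePow_neg_nonneg (hBMV : BMVProperty n)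
    {A B : Matrix (Fin n) (Fin n) ℂ} (hA : A.PosSemidef) (hB : B.PosSemidef)
    {q : ℝ} (hq : 0 < q) (hpd : ∀ x : ℝ, 0 < x → (A + x • B).PosDef) (r : ℕ) {l h : ℝ}
    (hl : 0 < l) (hh : 0 ≤ h) :
    0 ≤ (-1) ^ r * (fwdDiff h)^[r] (tracePow A B (-q)) l := by
  -- For fixed t > 0 this is, in x, the BMV function of the pair -tA, tB.
  set E : ℝ → ℝ → ℝ := fun x t => (NormedSpace.exp (-t • A - x • (t • B))).trace.re with hE
  have hEsum : ∀ x : ℝ, ∀ hx : 0 < x, ∀ t,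
      E x t = ∑ i, Real.exp (-((hpd x hx).1.eigenvalues i * t)) := by
    intro x hx t
    have h1 : -t • A - x • (t • B) = (-t) • (A + x • B) := by
      rw [smul_add, smul_smul, smul_smul, sub_eq_add_neg, ← neg_smul]
      congr 2
      ring
    rw [hE]
    simp only
    rw [h1, (hpd x hx).1.re_trace_exp]
    refine Finset.sum_congr rfl fun i _ => ?_
    congr 1
    ring
  have hintegrable : ∀ x : ℝ, l ≤ x →
      IntegrableOn (fun t => t ^ (q - 1) * E x t) (Set.Ioi 0) := by
    intro x hx
    have hx0 := hl.trans_le hx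
    simp only [hEsum x hx0, Finset.mul_sum]
    exact integrable_finsetSum _ fun i _ =>
      integrableOn_rpow_mul_exp_neg hq ((hpd x hx0).eigenvalues_pos i)
  have hrep : ∀ x : ℝ, l ≤ x → tracePow A B (-q) x =
      ((Real.Gamma q)⁻¹ • fun x => ∫ t in Set.Ioi (0 : ℝ), t ^ (q - 1) * E x t) x := by
    intro x hx
    have hx0 := hl.trans_le hx
    rw [tracePow_eq_sum (hpd x hx0).1, Pi.smul_apply, smul_eq_mul]
    simp only [hEsum x hx0, Finset.mul_sum]
    rw [integral_finsetSum _ fun i _ =>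
      integrableOn_rpow_mul_exp_neg hq ((hpd x hx0).eigenvalues_pos i), Finset.mul_sum]
    refine Finset.sum_congr rfl fun i _ => ?_
    have he := (hpd x hx0).eigenvalues_pos i
    rw [Real.integral_rpow_mul_exp_neg_mul_Ioi hq he, one_div, Real.inv_rpow he.le,
      Real.rpow_neg he.le]
    have := (Real.Gamma_pos_of_pos hq).ne'
    field_simp
  rw [fwdDiff_iter_congr hh r hrep, fwdDiff_iter_const_smul, Pi.smul_apply, smul_eq_mul,
    mul_left_comm, fwdDiff_iter_integral hh r hintegrable, ← integral_const_mul]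
  refine mul_nonneg (inv_nonneg.2 (Real.Gamma_pos_of_pos hq).le) ?_
  refine setIntegral_nonneg measurableSet_Ioi fun t ht => ?_
  have ht0 : 0 < t := ht
  have h1 : (fun x : ℝ => t ^ (q - 1) * E x t) = t ^ (q - 1) • fun x : ℝ => E x t := rfl
  rw [h1, fwdDiff_iter_const_smul, Pi.smul_apply, smul_eq_mul, mul_left_comm]
  refine mul_nonneg (Real.rpow_nonneg ht0.le _) ?_
  refine (hBMV (-t • A) (t • B) ?_ (hB.smul ht0.le)).fwdDiff_iter_nonneg hh r l
  rw [Matrix.IsHermitian, Matrix.conjTranspose_smul, hA.1.eq, star_trivial]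

end NegativePowers

/-! ### Integer powers -/

section Polynomials

variable {n : ℕ}

theorem iteratedDeriv_polynomial_eval (P : Polynomial ℝ) (r : ℕ) :
    iteratedDeriv r (fun x => P.eval x) = fun x => (Polynomial.derivative^[r] P).eval x := by
  induction r with
  | zero => simp
  | succ r ih =>
    rw [iteratedDeriv_succ, ih, Function.iterate_succ_apply']
    ext x
    rw [Polynomial.deriv]

/-- The factor C makes the induction work: splitting off one factor A + l B replaces C by C A and C
B. -/
theorem exists_polynomial_re_trace_mul_pow (A B C : Matrix (Fin n) (Fin n) ℂ) (k : ℕ) :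
    ∃ P : Polynomial ℝ, P.natDegree ≤ k ∧ P.coeff k = (C * B ^ k).trace.re ∧
      ∀ l : ℝ, (C * (A + l • B) ^ k).trace.re = P.eval l := by
  induction k generalizing C with
  | zero => exact ⟨Polynomial.C C.trace.re, by simp, by simp, by simp⟩
  | succ k ih =>
    obtain ⟨P, hP, hPc, hPe⟩ := ih (C * A)
    obtain ⟨Q, hQ, hQc, hQe⟩ := ih (C * B)
    refine ⟨P + Polynomial.X * Q, ?_, ?_, fun l => ?_⟩
    · refine (Polynomial.natDegree_add_le _ _).trans (max_le (by omega) ?_)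
      refine Polynomial.natDegree_mul_le.trans ?_
      have := Polynomial.natDegree_X_le (R := ℝ)
      omega
    · rw [Polynomial.coeff_add, Polynomial.coeff_X_mul, hQc,
        Polynomial.coeff_eq_zero_of_natDegree_lt (by omega), zero_add, pow_succ', mul_assoc]
    · rw [pow_succ', ← mul_assoc, mul_add, add_mul, Matrix.trace_add, Complex.add_re, hPe]
      simp only [mul_smul_comm, smul_mul_assoc, Matrix.trace_smul, Complex.smul_re, hQe]
      simp

theorem exists_polynomial_tracePow_natCast {A B : Matrix (Fin n) (Fin n) ℂ} (hA : A.IsHermitian)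
    (hB : B.IsHermitian) (k : ℕ) :
    ∃ P : Polynomial ℝ, P.natDegree ≤ k ∧ P.coeff k = (B ^ k).trace.re ∧
      ∀ l, tracePow A B k l = P.eval l := by
  obtain ⟨P, hP, hPc, hPe⟩ := exists_polynomial_re_trace_mul_pow A B 1 k
  refine ⟨P, hP, by simpa using hPc, fun l => ?_⟩
  rw [← hPe, one_mul, tracePow, matrixPow]
  simp only [Real.rpow_natCast]
  have hsa : IsSelfAdjoint (A + l • B) := isHermitian_add_smul hA hB l
  rw [cfc_pow_id (R := ℝ) (A + l • B) k hsa]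

theorem fwdDiff_iter_tracePow_natCast_eq_zero {A B : Matrix (Fin n) (Fin n) ℂ}
    (hA : A.IsHermitian) (hB : B.IsHermitian) {k r : ℕ} (hkr : k < r) {l h : ℝ} (hl : 0 < l)
    (hh : 0 < h) : (fwdDiff h)^[r] (tracePow A B k) l = 0 := by
  obtain ⟨P, hP, -, hPe⟩ := exists_polynomial_tracePow_natCast hA hB k
  rw [funext hPe]
  obtain ⟨ξ, -, hξ⟩ := exists_fwdDiff_iter_eq r hh (fun x => P.eval x)
    (fun x _ => by simpa using (P.contDiff_aeval (𝕜 := ℝ) _).contDiffAt) hl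
  rw [hξ, iteratedDeriv_polynomial_eval, Polynomial.iterate_derivative_eq_zero (by omega)]
  simp

theorem iteratedDeriv_tracePow_natCast_nonneg {A B : Matrix (Fin n) (Fin n) ℂ}
    (hA : A.IsHermitian) (hB : B.PosSemidef) {m r : ℕ} (hmr : m ≤ r) (l : ℝ) :
    0 ≤ (-1 : ℝ) ^ (r - m) * iteratedDeriv r (tracePow A B m) l := by
  obtain ⟨P, hP, hPc, hPe⟩ := exists_polynomial_tracePow_natCast hA hB.1 m
  rw [funext hPe, iteratedDeriv_polynomial_eval]
  rcases hmr.eq_or_lt with rfl | hlt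
  · have hconst : Polynomial.derivative^[m] P = Polynomial.C ((m.factorial : ℝ) * P.coeff m) := by
      rw [Polynomial.eq_C_of_natDegree_eq_zero (p := Polynomial.derivative^[m] P),
        Polynomial.coeff_iterate_derivative, zero_add, Nat.descFactorial_self, nsmul_eq_mul]
      have := Polynomial.natDegree_iterate_derivative P m
      omega
    have htr : 0 ≤ (B ^ m).trace.re := (Complex.nonneg_iff.1 (hB.pow m).trace_nonneg).1
    rw [hconst, hPc, Nat.sub_self, pow_zero, one_mul]
    simp only [Polynomial.eval_C]
    positivity
  · rw [Polynomial.iterate_derivative_eq_zero (by omega)]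
    simp

end Polynomials

/-! ### The trace of the resolvent -/

section Resolvent

variable {n : ℕ}

/-- The weights are the diagonal entries of C in an eigenbasis of K, so one choice serves every f.
-/
theorem Matrix.IsHermitian.exists_weights_re_trace_cfc_mul {K : Matrix (Fin n) (Fin n) ℂ}
    (hK : K.IsHermitian) {C : Matrix (Fin n) (Fin n) ℂ} (hC : C.PosSemidef) :
    ∃ w : Fin n → ℝ, (∀ i, 0 ≤ w i) ∧
      ∀ f : ℝ → ℝ, (cfc f K * C).trace.re = ∑ i, w i * f (hK.eigenvalues i) := by
  set U := (hK.eigenvectorUnitary : Matrix (Fin n) (Fin n) ℂ) with hU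
  have hps : (star U * C * U).PosSemidef := hC.conjTranspose_mul_mul_same U
  refine ⟨fun i => ((star U * C * U) i i).re,
    fun i => (Complex.nonneg_iff.1 hps.diag_nonneg).1, fun f => ?_⟩
  rw [hK.cfc_eq, Matrix.IsHermitian.cfc, Unitary.conjStarAlgAut_apply, mul_assoc, mul_assoc,
    Matrix.trace_mul_comm, mul_assoc, ← hU, Matrix.trace, Complex.re_sum]
  refine Finset.sum_congr rfl fun i _ => ?_
  rw [Matrix.diag_apply, Matrix.diagonal_mul]
  simp [mul_comm]

theorem Matrix.IsHermitian.inv_eq_cfc {M : Matrix (Fin n) (Fin n) ℂ} (hM : M.IsHermitian)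
    (a b : ℝ) (hne : ∀ i, a + b * hM.eigenvalues i ≠ 0) :
    (a • (1 : Matrix (Fin n) (Fin n) ℂ) + b • M)⁻¹ = cfc (fun x : ℝ => (a + b * x)⁻¹) M := by
  have hsa : IsSelfAdjoint M := hM
  refine Matrix.inv_eq_right_inv ?_
  have h1 : a • (1 : Matrix (Fin n) (Fin n) ℂ) + b • M = cfc (fun x : ℝ => a + b * x) M := by
    rw [cfc_add .., cfc_const .., cfc_const_mul_id .., Algebra.algebraMap_eq_smul_one]
  rw [h1, ← cfc_mul (fun x : ℝ => a + b * x) (fun x : ℝ => (a + b * x)⁻¹) M (by fun_prop)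
    (M.finite_real_spectrum.continuousOn _), cfc_congr (g := fun _ => 1), cfc_const_one ℝ M]
  intro x hx
  obtain ⟨i, rfl⟩ := (hM.spectrum_real_eq_range_eigenvalues ▸ hx : x ∈ Set.range _)
  exact mul_inv_cancel₀ (hne i)

/-- The trace of the resolvent of `A + x B` at `-t` is a positive combination of functions
`x ↦ 1 / (1 + x b)` with `b ≥ 0`. -/
theorem exists_weights_resolvent {A B : Matrix (Fin n) (Fin n) ℂ}
    (hA : A.PosSemidef) (hB : B.PosSemidef) {t : ℝ} (ht : 0 < t) :
    ∃ w b : Fin n → ℝ, (∀ i, 0 ≤ w i) ∧ (∀ i, 0 ≤ b i) ∧ ∀ x : ℝ, ∀ hx : 0 ≤ x,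
      ∑ i, (t + (hA.add_smul hB hx).1.eigenvalues i)⁻¹ = ∑ i, w i * (1 + x * b i)⁻¹ := by
  have hN : (A + t • (1 : Matrix (Fin n) (Fin n) ℂ)).PosDef :=
    Matrix.PosDef.posSemidef_add hA (Matrix.PosDef.one.smul ht)
  -- With S² = A + t and K = S⁻¹ B S⁻¹, one has t + A + x B = S (1 + x K) S. The resolvent trace is
  -- then that of (1 + x K)⁻¹ S⁻², and only the scalar x varies.
  obtain ⟨S, hS, hSu, hSS⟩ := hN.exists_isHermitian_isUnit_mul_self
  have hSd : IsUnit S.det := (Matrix.isUnit_iff_isUnit_det _).1 hSu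
  have hSi : S⁻¹.IsHermitian := hS.inv
  have hK : (S⁻¹ * B * S⁻¹).PosSemidef := by
    have := hB.mul_mul_conjTranspose_same S⁻¹
    rwa [hSi.eq] at this
  have hC : (S⁻¹ * S⁻¹).PosSemidef := by
    have := Matrix.posSemidef_self_mul_conjTranspose S⁻¹
    rwa [hSi.eq] at this
  obtain ⟨w, hw, hwf⟩ := hK.1.exists_weights_re_trace_cfc_mul hC
  refine ⟨w, hK.1.eigenvalues, hw, hK.eigenvalues_nonneg, fun x hx => ?_⟩
  have hM := hA.add_smul hB hx
  have hne1 : ∀ i, 1 + x * hK.1.eigenvalues i ≠ 0 := fun i => by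
    have := mul_nonneg hx (hK.eigenvalues_nonneg i)
    positivity
  have hne2 : ∀ i, t + 1 * hM.1.eigenvalues i ≠ 0 := fun i => by
    have := hM.eigenvalues_nonneg i
    positivity
  have h1 := hM.1.re_trace_cfc (fun e => (t + 1 * e)⁻¹)
  rw [← hM.1.inv_eq_cfc t 1 hne2] at h1
  have h2 := hwf (fun e => (1 + x * e)⁻¹)
  rw [← hK.1.inv_eq_cfc 1 x hne1] at h2
  simp only [one_mul] at h1
  rw [← h1, ← h2]
  have hSl : S⁻¹ * S = 1 := Matrix.nonsing_inv_mul S hSd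
  have hSr : S * S⁻¹ = 1 := Matrix.mul_nonsing_inv S hSd
  have h3 : t • (1 : Matrix (Fin n) (Fin n) ℂ) + (1 : ℝ) • (A + x • B) =
      S * ((1 : ℝ) • (1 : Matrix (Fin n) (Fin n) ℂ) + x • (S⁻¹ * B * S⁻¹)) * S := by
    rw [one_smul, one_smul, mul_add, add_mul, mul_one, hSS, mul_smul_comm, smul_mul_assoc]
    rw [show S * (S⁻¹ * B * S⁻¹) * S = (S * S⁻¹) * B * (S⁻¹ * S) by simp only [mul_assoc], hSl, hSr,
      one_mul, mul_one]
    abel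
  rw [h3, Matrix.mul_inv_rev, Matrix.mul_inv_rev, Matrix.trace_mul_comm, mul_assoc]

theorem fwdDiff_iter_resolvent_nonneg {A B : Matrix (Fin n) (Fin n) ℂ}
    (hA : A.PosSemidef) (hB : B.PosSemidef) {t : ℝ} (ht : 0 < t) {R : ℝ → ℝ}
    (hR : ∀ x : ℝ, ∀ hx : 0 ≤ x, R x = ∑ i, (t + (hA.add_smul hB hx).1.eigenvalues i)⁻¹)
    {l h : ℝ} (hl : 0 ≤ l) (hh : 0 ≤ h) (r : ℕ) : 0 ≤ (-1) ^ r * (fwdDiff h)^[r] R l := by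
  obtain ⟨w, b, hw, hb, hwb⟩ := exists_weights_resolvent hA hB ht
  have h1 : ∀ x, l ≤ x → R x = (∑ i, w i • fun x : ℝ => (1 + x * b i)⁻¹) x := fun x hx => by
    rw [hR x (hl.trans hx), hwb x (hl.trans hx), Finset.sum_apply]
    rfl
  rw [fwdDiff_iter_congr hh r h1, fwdDiff_iter_finsetSum, Finset.sum_apply, Finset.mul_sum]
  refine Finset.sum_nonneg fun i _ => ?_
  rw [fwdDiff_iter_const_smul, Pi.smul_apply, smul_eq_mul, mul_left_comm]
  exact mul_nonneg (hw i) (fwdDiff_iter_one_add_mul_inv_nonneg (hb i) hl hh r)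

end Resolvent

/-! ### Fractional positive powers without BMV -/

section PositivePowers

open MeasureTheory

variable {n : ℕ}

/-- Division of e^m by t + e, with remainder (-t)^m. Multiplying by e and using e/(t + e) = 1 - t/(t
+ e) shifts the coefficients and adds the constant -(-t)^m. -/
theorem exists_pow_mul_inv_sub_inv_eq {t : ℝ} (ht : 0 < t) (m : ℕ) :
    ∃ a : ℕ → ℝ, ∀ e : ℝ, 0 ≤ e → e ^ m * (t⁻¹ - (t + e)⁻¹) =
      ∑ j ∈ Finset.range (m + 1), a j * e ^ j - (-t) ^ m * (t + e)⁻¹ := by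
  induction m with
  | zero => exact ⟨fun _ => t⁻¹, by simp⟩
  | succ m ih =>
    obtain ⟨a, ha⟩ := ih
    refine ⟨fun j => if j = 0 then -(-t) ^ m else a (j - 1), fun e he => ?_⟩
    have h1 : e * (t + e)⁻¹ = 1 - t * (t + e)⁻¹ := by
      have : t + e ≠ 0 := by positivity
      field_simp
      ring
    rw [pow_succ', mul_assoc, ha e he, mul_sub, Finset.sum_range_succ' _ (m + 1), Finset.mul_sum,
      mul_left_comm, h1]
    simp only [Nat.add_eq_zero_iff, one_ne_zero, and_false, if_false, Nat.add_sub_cancel, if_true,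
      pow_zero]
    rw [Finset.sum_congr rfl fun j _ => show e * (a j * e ^ j) = a j * e ^ (j + 1) by ring]
    ring

theorem fwdDiff_iter_tracePow_nonneg {A B : Matrix (Fin n) (Fin n) ℂ} (hA : A.PosSemidef)
    (hB : B.PosSemidef) (m : ℕ) {q : ℝ} (hq : q ∈ Set.Ioo (0 : ℝ) 1) {r : ℕ} (hr : m + 1 ≤ r)
    {l h : ℝ} (hl : 0 < l) (hh : 0 < h) :
    0 ≤ (-1 : ℝ) ^ (r - (m + 1)) * (fwdDiff h)^[r] (tracePow A B (m + q)) l := by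
  classical
  set e : ℝ → Fin n → ℝ := fun x i =>
    if hx : 0 ≤ x then (hA.add_smul hB hx).1.eigenvalues i else 0 with he
  have he0 : ∀ x i, 0 ≤ e x i := fun x i => by
    by_cases hx : 0 ≤ x
    · simp only [he, dif_pos hx]
      exact (hA.add_smul hB hx).eigenvalues_nonneg i
    · simp only [he, dif_neg hx, le_refl]
  have hpow : ∀ x : ℝ, 0 ≤ x → ∀ s : ℝ, tracePow A B s x = ∑ i, e x i ^ s := fun x hx s => by
    rw [tracePow_eq_sum (hA.add_smul hB hx).1]
    simp only [he, dif_pos hx]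
  set c : ℝ := (∫ t in Set.Ioi (0 : ℝ), q.rpowIntegrand₀₁ t 1)⁻¹ with hc
  have hc0 : 0 ≤ c := inv_nonneg.2 (setIntegral_nonneg measurableSet_Ioi fun t ht =>
    Real.rpowIntegrand₀₁_nonneg hq.1 (Set.mem_Ioi.1 ht).le zero_le_one)
  set G : ℝ → ℝ → ℝ := fun x t => ∑ i, e x i ^ m * q.rpowIntegrand₀₁ t (e x i) with hG
  have hintegrable : ∀ x i, IntegrableOn (fun t => e x i ^ m * q.rpowIntegrand₀₁ t (e x i)) (Set.Ioi 0) :=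
    fun x i => (Real.integrableOn_rpowIntegrand₀₁_Ioi hq (he0 x i)).const_mul _
  have hGint : ∀ x, l ≤ x → IntegrableOn (G x) (Set.Ioi 0) := fun x _ =>
    integrable_finsetSum _ fun i _ => hintegrable x i
  have hrep : ∀ x, l ≤ x →
      tracePow A B (m + q) x = (c • fun x => ∫ t in Set.Ioi (0 : ℝ), G x t) x := by
    intro x hx
    rw [hpow x (hl.le.trans hx), Pi.smul_apply, smul_eq_mul]
    simp only [hG]
    rw [integral_finsetSum _ fun i _ => hintegrable x i, Finset.mul_sum]
    refine Finset.sum_congr rfl fun i _ => ?_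
    have hmq : (m : ℝ) + q ≠ 0 := by
      have := hq.1
      positivity
    rw [integral_const_mul, Real.rpow_add' (he0 x i) hmq, Real.rpow_natCast, mul_left_comm,
      Real.rpow_eq_const_mul_integral hq (he0 x i)]
  rw [fwdDiff_iter_congr hh.le r hrep, fwdDiff_iter_const_smul, Pi.smul_apply, smul_eq_mul,
    mul_left_comm, fwdDiff_iter_integral hh.le r hGint, ← integral_const_mul]
  refine mul_nonneg hc0 (setIntegral_nonneg measurableSet_Ioi fun t ht => ?_)
  have ht0 : 0 < t := ht
  obtain ⟨a, ha⟩ := exists_pow_mul_inv_sub_inv_eq ht0 m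
  set R : ℝ → ℝ := fun x => ∑ i, (t + e x i)⁻¹ with hR
  have hGt : ∀ x, l ≤ x → G x t = ((∑ j ∈ Finset.range (m + 1), (t ^ q * a j) • tracePow A B j) +
      (-(t ^ q * (-t) ^ m)) • R) x := by
    intro x hx
    rw [Pi.add_apply, Pi.smul_apply, Finset.sum_apply, smul_eq_mul]
    simp only [Pi.smul_apply, smul_eq_mul, hpow x (hl.le.trans hx), Real.rpow_natCast, hR, hG,
      Real.rpowIntegrand₀₁]
    calc ∑ i, e x i ^ m * (t ^ q * (t⁻¹ - (t + e x i)⁻¹))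
        = ∑ i, (t ^ q * ∑ j ∈ Finset.range (m + 1), a j * e x i ^ j -
            t ^ q * (-t) ^ m * (t + e x i)⁻¹) := by
          refine Finset.sum_congr rfl fun i _ => ?_
          rw [mul_left_comm, ha _ (he0 x i)]
          ring
      _ = _ := by
          rw [Finset.sum_sub_distrib, ← Finset.mul_sum, ← Finset.mul_sum, Finset.sum_comm,
            Finset.mul_sum, neg_mul, ← sub_eq_add_neg]
          congr 1
          refine Finset.sum_congr rfl fun j _ => ?_
          rw [← Finset.mul_sum, mul_assoc]
  have hpoly : (fwdDiff h)^[r] (∑ j ∈ Finset.range (m + 1), (t ^ q * a j) • tracePow A B j) l = 0 := by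
    rw [fwdDiff_iter_finsetSum, Finset.sum_apply]
    refine Finset.sum_eq_zero fun j hj => ?_
    rw [Finset.mem_range] at hj
    rw [fwdDiff_iter_const_smul, Pi.smul_apply,
      fwdDiff_iter_tracePow_natCast_eq_zero hA.1 hB.1 (by omega) hl hh, smul_zero]
  have hRnn := fwdDiff_iter_resolvent_nonneg hA hB ht0 (R := R)
    (fun x hx => by simp only [hR, he, dif_pos hx]) hl.le hh.le r
  rw [fwdDiff_iter_congr hh.le r hGt, fwdDiff_iter_add, Pi.add_apply, hpoly, zero_add,
    fwdDiff_iter_const_smul, Pi.smul_apply, smul_eq_mul]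
  obtain ⟨k, rfl⟩ := Nat.exists_eq_add_of_le hr
  rw [Nat.add_sub_cancel_left]
  -- The factor -(-t)^m supplies (-1)^(m+1), which completes (-1)^k to the sign (-1)^r of the
  -- resolvent.
  have hsign : (-1 : ℝ) ^ k * (-(t ^ q * (-t) ^ m) * (fwdDiff h)^[m + 1 + k] R l) =
      t ^ q * t ^ m * ((-1) ^ (m + 1 + k) * (fwdDiff h)^[m + 1 + k] R l) := by
    rw [neg_pow t, pow_add, pow_succ]
    ring
  rw [hsign]
  exact mul_nonneg (by positivity) hRnn

end PositivePowers

/-! ### Removing the common kernel -/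

section Kernel

variable {n : ℕ}

/-- The orthogonal projection onto the kernel of a Hermitian matrix. -/
noncomputable def kernelProj (M : Matrix (Fin n) (Fin n) ℂ) : Matrix (Fin n) (Fin n) ℂ :=
  cfc (fun x : ℝ => if x = 0 then 1 else 0) M

theorem kernelProj_isHermitian (M : Matrix (Fin n) (Fin n) ℂ) : (kernelProj M).IsHermitian :=
  cfc_predicate (R := ℝ) (p := IsSelfAdjoint) _ M

theorem mul_kernelProj {M : Matrix (Fin n) (Fin n) ℂ} (hM : M.IsHermitian) :
    M * kernelProj M = 0 := by
  have hsa : IsSelfAdjoint M := hM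
  have hc := fun f => M.finite_real_spectrum.continuousOn (f : ℝ → ℝ)
  conv_lhs => enter [1]; rw [← cfc_id' ℝ M]
  rw [kernelProj, ← cfc_mul (fun x : ℝ => x) (fun x : ℝ => if x = 0 then 1 else 0) M (hc _) (hc _),
    cfc_congr (g := fun _ => 0), cfc_const_zero ℝ M]
  intro x _
  by_cases hx : x = 0 <;> simp [hx]

theorem kernelProj_mul_of_mul_eq_zero {M X : Matrix (Fin n) (Fin n) ℂ} (hM : M.IsHermitian)
    (hX : M * X = 0) : kernelProj M * X = X := by
  have hsa : IsSelfAdjoint M := hM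
  have hc := fun f => M.finite_real_spectrum.continuousOn (f : ℝ → ℝ)
  -- As `0⁻¹ = 0`, the second term is the pseudo-inverse of M times M, the complementary projection.
  have h1 : kernelProj M + cfc (fun x : ℝ => x⁻¹) M * M = 1 := by
    conv_lhs => enter [2, 2]; rw [← cfc_id' ℝ M]
    rw [kernelProj, ← cfc_mul (fun x : ℝ => x⁻¹) (fun x : ℝ => x) M (hc _) (hc _),
      ← cfc_add M _ _ (hc _) (hc _), cfc_congr (g := fun _ => 1), cfc_const_one ℝ M]
    intro x _
    by_cases hx : x = 0 <;> simp [hx]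
  calc kernelProj M * X = (kernelProj M + cfc (fun x : ℝ => x⁻¹) M * M) * X := by
        rw [add_mul, mul_assoc _ M X, hX, mul_zero, add_zero]
    _ = X := by rw [h1, one_mul]

theorem mul_eq_zero_of_add_smul_mul_eq_zero {A B X : Matrix (Fin n) (Fin n) ℂ}
    (hA : A.PosSemidef) (hB : B.PosSemidef) {l : ℝ} (hl : 0 < l) (hX : (A + l • B) * X = 0) :
    A * X = 0 ∧ B * X = 0 := by
  have key : ∀ v : Fin n → ℂ, A.mulVec (X.mulVec v) = 0 ∧ B.mulVec (X.mulVec v) = 0 := by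
    intro v
    set y := X.mulVec v with hy
    have h0 : (A + l • B).mulVec y = 0 := by rw [hy, Matrix.mulVec_mulVec, hX, Matrix.zero_mulVec]
    have h1 := hA.dotProduct_mulVec_nonneg y
    have h2 := (hB.smul hl.le).dotProduct_mulVec_nonneg y
    have h3 : star y ⬝ᵥ A.mulVec y + star y ⬝ᵥ (l • B).mulVec y = 0 := by
      rw [← dotProduct_add, ← Matrix.add_mulVec, h0, dotProduct_zero]
    obtain ⟨h4, h5⟩ := (add_eq_zero_iff_of_nonneg h1 h2).1 h3
    refine ⟨(hA.dotProduct_mulVec_zero_iff y).1 h4, ?_⟩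
    have h6 := ((hB.smul hl.le).dotProduct_mulVec_zero_iff y).1 h5
    rw [Matrix.smul_mulVec] at h6
    exact (smul_eq_zero.1 h6).resolve_left hl.ne'
  constructor <;> refine Matrix.ext_of_mulVec_single fun i => ?_
  · rw [← Matrix.mulVec_mulVec, (key _).1, Matrix.zero_mulVec]
  · rw [← Matrix.mulVec_mulVec, (key _).2, Matrix.zero_mulVec]

/-- For l > 0 both quadratic forms vanish on the kernel of A + l B, so it is ker A ∩ ker B,
independent of l. The two projections absorb each other, and adjoints give equality. -/
theorem kernelProj_add_smul_eq {A B : Matrix (Fin n) (Fin n) ℂ} (hA : A.PosSemidef)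
    (hB : B.PosSemidef) {l l' : ℝ} (hl : 0 < l) (hl' : 0 < l') :
    kernelProj (A + l • B) = kernelProj (A + l' • B) := by
  have key : ∀ s t : ℝ, 0 < s → 0 < t →
      kernelProj (A + s • B) * kernelProj (A + t • B) = kernelProj (A + t • B) := by
    intro s t hs ht
    obtain ⟨h1, h2⟩ := mul_eq_zero_of_add_smul_mul_eq_zero hA hB ht
      (mul_kernelProj (isHermitian_add_smul hA.1 hB.1 t))
    refine kernelProj_mul_of_mul_eq_zero (isHermitian_add_smul hA.1 hB.1 s) ?_
    rw [add_mul, smul_mul_assoc, h1, h2, smul_zero, add_zero]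
  have h := congrArg Matrix.conjTranspose (key l l' hl hl')
  rw [Matrix.conjTranspose_mul, (kernelProj_isHermitian _).eq, (kernelProj_isHermitian _).eq,
    key l' l hl' hl] at h
  exact h

theorem posSemidef_kernelProj {M : Matrix (Fin n) (Fin n) ℂ} (hM : M.IsHermitian) :
    (kernelProj M).PosSemidef := by
  have h := Matrix.posSemidef_self_mul_conjTranspose (kernelProj M)
  rwa [(kernelProj_isHermitian M).eq,
    kernelProj_mul_of_mul_eq_zero hM (mul_kernelProj hM)] at h

theorem Matrix.IsHermitian.add_kernelProj_eq_cfc {M : Matrix (Fin n) (Fin n) ℂ}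
    (hM : M.IsHermitian) :
    M + kernelProj M = cfc (fun x : ℝ => x + if x = 0 then 1 else 0) M := by
  have hsa : IsSelfAdjoint M := hM
  have hc := fun f => M.finite_real_spectrum.continuousOn (f : ℝ → ℝ)
  rw [cfc_add M (fun x : ℝ => x) _ (hc _) (hc _), cfc_id' ℝ M, kernelProj]

theorem Matrix.PosSemidef.posDef_add_kernelProj {M : Matrix (Fin n) (Fin n) ℂ}
    (hM : M.PosSemidef) : (M + kernelProj M).PosDef := by
  have hsa : IsSelfAdjoint M := hM.1
  have hc := fun f => M.finite_real_spectrum.continuousOn (f : ℝ → ℝ)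
  rw [(hM.add (posSemidef_kernelProj hM.1)).posDef_iff_isUnit, hM.1.add_kernelProj_eq_cfc]
  refine IsUnit.of_mul_eq_one (cfc (fun x : ℝ => (x + if x = 0 then 1 else 0)⁻¹) M) ?_
  rw [← cfc_mul _ _ M (hc _) (hc _), cfc_congr (g := fun _ => 1), cfc_const_one ℝ M]
  intro x _
  by_cases hx : x = 0 <;> simp [hx]

/-- Only zero eigenvalues change, to 1; their old contribution is 0^p = 0. -/
theorem Matrix.PosSemidef.re_trace_rpow_add_kernelProj {M : Matrix (Fin n) (Fin n) ℂ}
    (hM : M.PosSemidef) {p : ℝ} (hp : 0 < p) :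
    (matrixPow (M + kernelProj M) p).trace.re =
      (matrixPow M p).trace.re + (kernelProj M).trace.re := by
  have hsa : IsSelfAdjoint M := hM.1
  have hcomp : cfc (fun x : ℝ => x ^ p) (cfc (fun x : ℝ => x + if x = 0 then 1 else 0) M) =
      cfc (fun x : ℝ => (x + if x = 0 then 1 else 0) ^ p) M :=
    (cfc_comp (fun x : ℝ => x ^ p) (fun x : ℝ => x + if x = 0 then 1 else 0) M hsa
      ((M.finite_real_spectrum.image _).continuousOn _) (M.finite_real_spectrum.continuousOn _)).symm
  rw [matrixPow, matrixPow, hM.1.add_kernelProj_eq_cfc, hcomp, hM.1.re_trace_cfc,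
    hM.1.re_trace_cfc, kernelProj, hM.1.re_trace_cfc, ← Finset.sum_add_distrib]
  refine Finset.sum_congr rfl fun i _ => ?_
  by_cases hx : hM.1.eigenvalues i = 0 <;> simp [hx, Real.zero_rpow hp.ne']

/-- Adding the projection onto the common kernel makes `A + l B` positive definite for `l > 0` and
changes the trace of its positive powers by a constant. -/
theorem exists_posDef_tracePow_eq {A B : Matrix (Fin n) (Fin n) ℂ} (hA : A.PosSemidef)
    (hB : B.PosSemidef) {p : ℝ} (hp : 0 < p) :
    ∃ (A' : Matrix (Fin n) (Fin n) ℂ) (k : ℝ), A'.PosSemidef ∧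
      (∀ l : ℝ, 0 < l → (A' + l • B).PosDef) ∧
      ∀ l : ℝ, 0 < l → tracePow A B p l = tracePow A' B p l - k := by
  have hH := hA.add_smul hB zero_le_one
  have heq : ∀ l : ℝ, 0 < l → A + kernelProj (A + (1 : ℝ) • B) + l • B =
      (A + l • B) + kernelProj (A + l • B) := fun l hl => by
    rw [kernelProj_add_smul_eq hA hB one_pos hl]
    abel
  refine ⟨A + kernelProj (A + (1 : ℝ) • B), (kernelProj (A + (1 : ℝ) • B)).trace.re,
    hA.add (posSemidef_kernelProj hH.1), fun l hl => ?_, fun l hl => ?_⟩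
  · rw [heq l hl]
    exact (hA.add_smul hB hl.le).posDef_add_kernelProj
  · rw [tracePow, tracePow, heq l hl, (hA.add_smul hB hl.le).re_trace_rpow_add_kernelProj hp,
      kernelProj_add_smul_eq hA hB one_pos hl]
    ring

end Kernel

/-! ### Continuity up to the endpoint -/

section Continuity

open scoped Matrix.Norms.L2Operator

variable {n : ℕ}

theorem continuous_tracePow {A B : Matrix (Fin n) (Fin n) ℂ} (hA : A.IsHermitian)
    (hB : B.IsHermitian) {p : ℝ} (hp : 0 < p) : Continuous (tracePow A B p) := by
  have h1 : Continuous fun l : ℝ => cfc (fun x : ℝ => x ^ p) (A + l • B) :=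
    Continuous.cfc_of_mem_nhdsSet (s := Set.univ) (p := IsSelfAdjoint) _ Filter.univ_mem
      (by fun_prop) (fun l => isHermitian_add_smul hA hB l)
      (Real.continuous_rpow_const hp.le).continuousOn
  exact (traceRe n).continuous.comp h1

end Continuity

/-! ### Signs of the derivatives and the theorem -/

section Main

open scoped ContDiff Topology

variable {n : ℕ}

theorem contDiffAt_tracePow_of_pos {A B : Matrix (Fin n) (Fin n) ℂ} (hA : A.PosSemidef)
    (hB : B.PosSemidef) {p : ℝ} (hp : 0 < p) {l : ℝ} (hl : 0 < l) :
    ContDiffAt ℝ ∞ (tracePow A B p) l := by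
  obtain ⟨A', k, hA', hpd, heq⟩ := exists_posDef_tracePow_eq hA hB hp
  refine ((contDiffAt_tracePow hA'.1 hB.1 p (hpd l hl)).sub contDiffAt_const).congr_of_eventuallyEq
    (f := fun x => tracePow A' B p x - k) ?_
  filter_upwards [Ioi_mem_nhds hl] with x hx using heq x hx

theorem contDiff_tracePow_natCast {A B : Matrix (Fin n) (Fin n) ℂ} (hA : A.IsHermitian)
    (hB : B.IsHermitian) (m : ℕ) : ContDiff ℝ ∞ (tracePow A B m) := by
  obtain ⟨P, -, -, hPe⟩ := exists_polynomial_tracePow_natCast hA hB m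
  rw [funext hPe]
  simpa using P.contDiff_aeval (𝕜 := ℝ) ∞

theorem iteratedDeriv_tracePow_nonneg_of_ceil_le {A B : Matrix (Fin n) (Fin n) ℂ}
    (hA : A.PosSemidef) (hB : B.PosSemidef) {p : ℝ} (hp : 0 < p) {r : ℕ} (hr : ⌈p⌉ ≤ (r : ℤ))
    {l : ℝ} (hl : 0 < l) :
    0 ≤ (-1 : ℝ) ^ ((r : ℤ) - ⌈p⌉) * iteratedDeriv r (tracePow A B p) l := by
  obtain ⟨k, hk⟩ := Int.eq_ofNat_of_zero_le (Int.ceil_nonneg hp.le)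
  rw [hk] at hr ⊢
  have hkr : k ≤ r := by exact_mod_cast hr
  rw [← Nat.cast_sub hkr, zpow_natCast]
  by_cases hpk : p = k
  · rw [hpk]
    exact iteratedDeriv_tracePow_natCast_nonneg hA.1 hB hkr l
  have h1 : p < k := lt_of_le_of_ne (by simpa [hk] using Int.le_ceil p) hpk
  have h2 : (k : ℝ) - 1 < p := by
    have := Int.ceil_lt_add_one p
    rw [hk] at this
    push_cast at this
    linarith
  -- For non-integer p, m = ⌈p⌉ - 1 is the integer part and p - m lies in (0, 1).
  obtain ⟨m, rfl⟩ : ∃ m, k = m + 1 := ⟨k - 1, by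
    have : (0 : ℝ) < k := hp.trans h1
    have : 0 < k := by exact_mod_cast this
    omega⟩
  push_cast at h1 h2
  have hpm : (m : ℝ) + (p - m) = p := by ring
  refine iteratedDeriv_nonneg_of_fwdDiff_iter_nonneg
    (fun x hx => contDiffAt_tracePow_of_pos hA hB hp hx) (fun x h hx hh => ?_) hl
  have := fwdDiff_iter_tracePow_nonneg hA hB m (q := p - m) ⟨by linarith, by linarith⟩ hkr hx hh
  rwa [hpm] at this

theorem iteratedDeriv_tracePow_neg_nonneg (hBMV : BMVProperty n)
    {A B : Matrix (Fin n) (Fin n) ℂ} (hA : A.PosSemidef) (hB : B.PosSemidef)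
    {q : ℝ} (hq : 0 < q) (hpd : ∀ x : ℝ, 0 < x → (A + x • B).PosDef) (r : ℕ) {l : ℝ} (hl : 0 < l) :
    0 ≤ (-1 : ℝ) ^ r * iteratedDeriv r (tracePow A B (-q)) l :=
  iteratedDeriv_nonneg_of_fwdDiff_iter_nonneg
    (fun x hx => contDiffAt_tracePow hA.1 hB.1 (-q) (hpd x hx))
    (fun _ _ hx hh => fwdDiff_iter_tracePow_neg_nonneg hBMV hA hB hq hpd r hx hh.le) hl

theorem iteratedDeriv_tracePow_neg_zero_nonneg (hBMV : BMVProperty n)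
    {A B : Matrix (Fin n) (Fin n) ℂ} (hA : A.PosDef) (hB : B.PosSemidef)
    {q : ℝ} (hq : 0 < q) {r : ℕ} (hr : 1 ≤ r) :
    0 ≤ (-1 : ℝ) ^ r * iteratedDeriv r (tracePow A B (-q)) 0 := by
  have hpd : ∀ x : ℝ, 0 ≤ x → (A + x • B).PosDef := fun x hx => hA.add_smul hB hx
  have hs := contDiffAt_tracePow hA.1 hB.1 (-q) (hpd 0 le_rfl)
  have h := iteratedDerivWithin_Ici_nonneg hr (σ := (-1) ^ r)
    (fun x hx => contDiffAt_tracePow hA.1 hB.1 (-q) (hpd x hx.le))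
    (fun x hx => iteratedDeriv_tracePow_neg_nonneg hBMV hA.posSemidef hB hq
      (fun y hy => hpd y hy.le) r hx) le_rfl
  rwa [iteratedDerivWithin_eq_iteratedDeriv (uniqueDiffOn_Ici 0)
    (contDiffAt_infty.1 hs r) Set.self_mem_Ici] at h

/-- Reciprocity with q = p - r: the two signs (-1)^r cancel and q/p is positive. Scaling by c⁻¹
meets its norm condition and only multiplies the trace by a positive constant. -/
theorem iteratedDeriv_tracePow_zero_nonneg (hBMV : BMVProperty n)
    {A B : Matrix (Fin n) (Fin n) ℂ} (hA : A.PosDef) (hB : B.PosSemidef)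
    {p : ℝ} {r : ℕ} (hr : 1 ≤ r) (hrp : (r : ℝ) < p) :
    0 ≤ iteratedDeriv r (tracePow A B p) 0 := by
  obtain ⟨c, hc, hnorm⟩ := hA.exists_norm_inv_smul_sub_one_lt_one
  have hcA : (c⁻¹ • A).PosDef := hA.smul (inv_pos.2 hc)
  have hcB : (c⁻¹ • B).PosSemidef := hB.smul (inv_pos.2 hc).le
  have hq : 0 < p - r := sub_pos.2 hrp
  obtain ⟨A', B', hA', hB', heq⟩ := exists_iteratedDeriv_tracePow_neg_eq hcA hcB hnorm hq
  have h1 := iteratedDeriv_tracePow_neg_zero_nonneg hBMV hA' hB' hq hr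
  rw [heq r, sub_add_cancel, ← mul_assoc, ← mul_assoc, ← mul_pow, neg_one_mul, neg_neg, one_pow,
    one_mul] at h1
  have hp : 0 < p := (Nat.cast_nonneg r).trans_lt hrp
  have h2 : 0 ≤ iteratedDeriv r (tracePow (c⁻¹ • A) (c⁻¹ • B) p) 0 :=
    (mul_nonneg_iff_of_pos_left (div_pos hq hp)).1 h1
  have hs := contDiffAt_infty.1 (contDiffAt_tracePow hA.1 hB.1 p
    (hA.add_smul hB (le_refl (0 : ℝ)))) r
  have hs' := contDiffAt_infty.1 (contDiffAt_tracePow hcA.1 hcB.1 p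
    (hcA.add_smul hcB (le_refl (0 : ℝ)))) r
  have hu := uniqueDiffOn_Ici (0 : ℝ)
  -- Homogeneity is available only for l ≥ 0, hence the passage through one-sided derivatives.
  have hscale : Set.EqOn (tracePow (c⁻¹ • A) (c⁻¹ • B) p) (fun x => c⁻¹ ^ p * tracePow A B p x)
      (Set.Ici 0) := fun x hx => tracePow_smul hA.posSemidef hB p (inv_pos.2 hc) hx
  rw [← iteratedDerivWithin_eq_iteratedDeriv hu hs' Set.self_mem_Ici,
    iteratedDerivWithin_congr hscale Set.self_mem_Ici,
    iteratedDerivWithin_const_mul Set.self_mem_Ici hu _ hs.contDiffWithinAt,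
    iteratedDerivWithin_eq_iteratedDeriv hu hs Set.self_mem_Ici] at h2
  exact (mul_nonneg_iff_of_pos_left (Real.rpow_pos_of_pos (inv_pos.2 hc) p)).1 h2

theorem tracePow_add (A B : Matrix (Fin n) (Fin n) ℂ) (p l x : ℝ) :
    tracePow A B p (l + x) = tracePow (A + l • B) B p x := by
  rw [tracePow, tracePow, add_smul, add_assoc]

/-- The top order r = ⌈p⌉ needs no BMV. Otherwise r < p, and filling in the kernel and translating l
to 0 reduces to a positive definite A. -/
theorem iteratedDeriv_tracePow_nonneg (hBMV : BMVProperty n)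
    {A B : Matrix (Fin n) (Fin n) ℂ} (hA : A.PosSemidef) (hB : B.PosSemidef)
    {p : ℝ} {r : ℕ} (hr : 1 ≤ r) (hrp : (r : ℤ) ≤ ⌈p⌉) {l : ℝ} (hl : 0 < l) :
    0 ≤ iteratedDeriv r (tracePow A B p) l := by
  have hp : 0 < p := Int.ceil_pos.1 (by omega)
  rcases hrp.eq_or_lt with heq | hlt
  · have := iteratedDeriv_tracePow_nonneg_of_ceil_le hA hB hp heq.ge hl
    rwa [heq, sub_self, zpow_zero, one_mul] at this
  have hrp' : (r : ℝ) < p := by exact_mod_cast Int.lt_ceil.1 hlt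
  obtain ⟨A', k, hA', hpd, heq⟩ := exists_posDef_tracePow_eq hA hB hp
  have h1 := iteratedDeriv_tracePow_zero_nonneg hBMV (hpd l hl) hB hr hrp'
  have h2 : iteratedDeriv r (tracePow (A' + l • B) B p) 0 = iteratedDeriv r (tracePow A' B p) l := by
    rw [← funext (tracePow_add A' B p l), iteratedDeriv_comp_const_add]
    simp only [add_zero]
  have h3 : tracePow A B p =ᶠ[𝓝 l] fun x => -k + tracePow A' B p x := by
    filter_upwards [Ioi_mem_nhds hl] with x hx
    rw [heq x hx]
    ring
  rw [h3.iteratedDeriv_eq, iteratedDeriv_const_add hr, ← h2]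
  exact h1

theorem contDiffOn_Ici_tracePow (hBMV : BMVProperty n)
    {A B : Matrix (Fin n) (Fin n) ℂ} (hA : A.PosSemidef) (hB : B.PosSemidef)
    {p : ℝ} (hp : 0 < p) {r : ℕ} (hrp : (r : ℝ) ≤ p) :
    ContDiffOn ℝ r (tracePow A B p) (Set.Ici 0) := by
  rcases hrp.eq_or_lt with rfl | hlt
  · exact (contDiff_infty.1 (contDiff_tracePow_natCast hA.1 hB.1 r) r).contDiffOn
  · refine contDiffOn_Ici_of_iteratedDeriv_nonneg r (continuous_tracePow hA.1 hB.1 hp).continuousOn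
      (fun x hx => contDiffAt_tracePow_of_pos hA hB hp hx) fun j hj hjr x hx =>
      iteratedDeriv_tracePow_nonneg hBMV hA hB hj ?_ hx
    -- For r < p, order r + 1 is still at most ⌈p⌉, as the monotonicity argument requires.
    have : (r : ℤ) < ⌈p⌉ := Int.lt_ceil.2 (by exact_mod_cast hlt)
    omega

theorem contDiffAt_tracePow_of_pos_or_posDef {A B : Matrix (Fin n) (Fin n) ℂ} (hA : A.PosSemidef)
    (hB : B.PosSemidef) {p : ℝ} (hp : 0 < p) {l : ℝ} (hl : 0 ≤ l) (h : 0 < l ∨ A.PosDef) :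
    ContDiffAt ℝ ∞ (tracePow A B p) l := by
  rcases h with hl | hA'
  · exact contDiffAt_tracePow_of_pos hA hB hp hl
  · exact contDiffAt_tracePow hA.1 hB.1 p (hA'.add_smul hB hl)

/-- Zero eigenvalues count too, since `0 ^ 0 = 1`. -/
theorem tracePow_zero (A B : Matrix (Fin n) (Fin n) ℂ) (hA : A.IsHermitian) (hB : B.IsHermitian) :
    tracePow A B 0 = fun _ => (n : ℝ) := by
  ext l
  simp [tracePow_eq_sum (isHermitian_add_smul hA hB l)]

end Main

/-- The derivatives are those of the function on `[0, ∞)`, hence one-sided at `l = 0`. In the first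
two parts the implication to `ContDiffWithinAt` says where the derivatives exist. They can fail
to exist only at `l = 0`, for singular `A`, fractional `p` and `r > p`; there the sign is asserted of
`iteratedDerivWithin`, thus of the derivative if it exists. -/
theorem theorem2 (n : ℕ) (A B : Matrix (Fin n) (Fin n) ℂ) (hA : A.PosSemidef) (hB : B.PosSemidef)
    (p : ℝ) :
    (BMVProperty n → ∀ r : ℕ, 1 ≤ r → (r : ℤ) ≤ ⌈p⌉ → ∀ l : ℝ, 0 ≤ l →
      ((0 < l ∨ A.PosDef ∨ (r : ℝ) ≤ p) →
        ContDiffWithinAt ℝ r (tracePow A B p) (Set.Ici 0) l) ∧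
      0 ≤ iteratedDerivWithin r (tracePow A B p) (Set.Ici 0) l) ∧
    (0 < p → ∀ r : ℕ, ⌈p⌉ ≤ (r : ℤ) → ∀ l : ℝ, 0 ≤ l →
      ((0 < l ∨ A.PosDef ∨ p = ⌈p⌉) →
        ContDiffWithinAt ℝ r (tracePow A B p) (Set.Ici 0) l) ∧
      0 ≤ (-1 : ℝ) ^ ((r : ℤ) - ⌈p⌉) * iteratedDerivWithin r (tracePow A B p) (Set.Ici 0) l) ∧
    (BMVProperty n → p ≤ 0 → ∀ r : ℕ, 1 ≤ r → ∀ l : ℝ, 0 ≤ l →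
      (p < 0 → (A + l • B).PosDef) →
      ContDiffWithinAt ℝ r (tracePow A B p) (Set.Ici 0) l ∧
      0 ≤ (-1 : ℝ) ^ r * iteratedDerivWithin r (tracePow A B p) (Set.Ici 0) l) := by
  refine ⟨fun hBMV r hr hrp l hl => ?_, fun hp r hr l hl => ?_, fun hBMV hp r hr l hl hpd => ?_⟩
  · have hp : 0 < p := Int.ceil_pos.1 (by omega)
    refine ⟨fun h => ?_, ?_⟩
    · rcases or_assoc.2 h with h | h
      · exact (contDiffAt_infty.1
          (contDiffAt_tracePow_of_pos_or_posDef hA hB hp hl h) r).contDiffWithinAt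
      · exact contDiffOn_Ici_tracePow hBMV hA hB hp h l hl
    · simpa using iteratedDerivWithin_Ici_nonneg hr (σ := 1)
        (fun x hx => contDiffAt_tracePow_of_pos hA hB hp hx)
        (fun x hx => by simpa using iteratedDeriv_tracePow_nonneg hBMV hA hB hr hrp hx) hl
  · refine ⟨fun h => ?_, ?_⟩
    · rcases or_assoc.2 h with h | h
      · exact (contDiffAt_infty.1
          (contDiffAt_tracePow_of_pos_or_posDef hA hB hp hl h) r).contDiffWithinAt
      · obtain ⟨m, hm⟩ := Int.eq_ofNat_of_zero_le (Int.ceil_nonneg hp.le)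
        rw [hm] at h
        rw [show p = (m : ℝ) by exact_mod_cast h]
        exact (contDiff_infty.1 (contDiff_tracePow_natCast hA.1 hB.1 m) r).contDiffAt.contDiffWithinAt
    · have hr1 : 1 ≤ r := by
        have := Int.ceil_pos.2 hp
        omega
      exact iteratedDerivWithin_Ici_nonneg hr1
        (fun x hx => contDiffAt_tracePow_of_pos hA hB hp hx)
        (fun x hx => iteratedDeriv_tracePow_nonneg_of_ceil_le hA hB hp hr hx) hl
  · rcases hp.eq_or_lt with rfl | hp
    · rw [tracePow_zero A B hA.1 hB.1]
      refine ⟨contDiffWithinAt_const, ?_⟩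
      rw [iteratedDerivWithin_const, if_neg (by omega), mul_zero]
    · have hpd' : ∀ x : ℝ, 0 < x → (A + x • B).PosDef := fun x hx =>
        Matrix.PosDef.add_smul_of_add_smul hA hB (hpd hp) hx
      have hq : 0 < -p := neg_pos.2 hp
      refine ⟨(contDiffAt_infty.1
        (contDiffAt_tracePow hA.1 hB.1 p (hpd hp)) r).contDiffWithinAt, ?_⟩
      refine iteratedDerivWithin_Ici_nonneg hr
        (fun x hx => contDiffAt_tracePow hA.1 hB.1 p (hpd' x hx)) (fun x hx => ?_) hl
      simpa using iteratedDeriv_tracePow_neg_nonneg hBMV hA hB hq hpd' r hx
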